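/- Let $a_1,a_2$ be odd integers. Let $(a_1,a_2)$ denote the rational tangle obtained from two vertical strands by first twisting the two bottom endpoints $|a_1|$ times and then twisting the two right endpoints $|a_2|$ times, where the overstrand at each crossing of the $i$-th twist has positive slope if $a_i>0$ and negative slope if $a_i<0$. Consider a closure of this tangle (numerator closure: the two top endpoints are joined to each other and the two bottom endpoints to each other; denominator closure: the two left endpoints are joined and the two right endpoints are joined) that is a link diagram with exactly two components, and let $S$ be its shadow, in which no crossing is resolved. In the Linking-Unlinking Game on $S$, two players alternately resolve one unresolved crossing by choosing its overstrand, until all crossings are resolved. One player is the Linker, who wins if the final link diagram is unsplittable; the other is the Unlinker, who wins if it is splittable. Here a link diagram is splittable if planar isotopies and Reidemeister moves turn it into a diagram in which some of the components, at least one, lie inside a circle and the remaining components, at least one, lie outside it. Then the player who moves second has a winning strategy, whichever of the two roles they have. Moreover, this winning strategy can be chosen so that at the end of every play in which the second player follows it there is a sign $\varepsilon\in\{1,-1\}$ such that, with $\delta=1$ if the second player is the Linker and $\delta=-1$ if the second player is the Unlinker, the following holds. The number of crossings with overstrand of positive slope minus the number with overstrand of negative slope is $\varepsilon$ in the first twist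 and $\delta\varepsilon$ in the second twist, and the resolved tangle can be turned into the rational tangle $(\varepsilon,\delta\varepsilon)$ by planar isotopies and Reidemeister moves that keep the four endpoints fixed. -/

import Mathlib

/-! # Link and tangle diagrams in sliced form, and the Linking-Unlinking Game

A planar link or tangle diagram in general position with respect to the height function is cut by
horizontal lines into elementary layers, each of which contains one local maximum, one local
minimum, or one crossing, next to vertical strands. A diagram is the list of its layers, read from
top to bottom. In each layer the strands are numbered from the left, starting with `0`. -/

namespace LinkGame

/-- An elementary layer of a diagram whose crossings carry a decoration in `C`. -/
inductive Layer (C : Type) : Type where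
  /-- A local maximum `∩`: two new strands appear, in positions `i` and `i + 1`. -/
  | localMax (i : ℕ) : Layer C
  /-- A local minimum `∪`: the strands in positions `i` and `i + 1` are joined and end. -/
  | localMin (i : ℕ) : Layer C
  /-- The strands in positions `i` and `i + 1` cross. -/
  | cross (c : C) (i : ℕ) : Layer C

namespace Layer

variable {C C' : Type}

/-- The number of strands below the layer if there are `w` strands above it; `none` if the layer
does not fit under `w` strands. -/
def next : Layer C → ℕ → Option ℕ
  | localMax i, w => if i ≤ w then some (w + 2) else none
  | localMin i, w => if i + 2 ≤ w then some (w - 2) else none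
  | cross _ i, w => if i + 2 ≤ w then some w else none

/-- Move the layer `k` positions to the right. -/
def shift (k : ℕ) : Layer C → Layer C
  | localMax i => localMax (i + k)
  | localMin i => localMin (i + k)
  | cross c i => cross c (i + k)

/-- Change the decoration of the crossings. -/
def map (f : C → C') : Layer C → Layer C'
  | localMax i => localMax i
  | localMin i => localMin i
  | cross c i => cross (f c) i

/-- The number of strands that enter the nontrivial part of a layer from above. -/
def inputs : Layer C → ℕ
  | localMax _ => 0
  | localMin _ => 2
  | cross _ _ => 2

/-- The number of strands that leave the nontrivial part of a layer below. -/
def outputs : Layer C → ℕ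
  | localMax _ => 2
  | localMin _ => 0
  | cross _ _ => 2

/-- The position of the nontrivial part of a layer. -/
def pos : Layer C → ℕ
  | localMax i => i
  | localMin i => i
  | cross _ i => i

/-- `Joins ℓ (b, i) (b', j)`: inside the layer `ℓ` an arc runs from the `i`-th strand to the `j`-th
strand. Here `(false, i)` is the `i`-th strand on the upper boundary line of the layer and
`(true, i)` the `i`-th strand on the lower one. -/
inductive Joins : Layer C → Bool × ℕ → Bool × ℕ → Prop where
  | max_left {i j : ℕ} (h : j < i) : Joins (localMax i) (false, j) (true, j)
  | max_right {i j : ℕ} (h : i ≤ j) : Joins (localMax i) (false, j) (true, j + 2)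
  | max_turn {i : ℕ} : Joins (localMax i) (true, i) (true, i + 1)
  | min_left {i j : ℕ} (h : j < i) : Joins (localMin i) (false, j) (true, j)
  | min_right {i j : ℕ} (h : i ≤ j) : Joins (localMin i) (false, j + 2) (true, j)
  | min_turn {i : ℕ} : Joins (localMin i) (false, i) (false, i + 1)
  | cross_fixed {c : C} {i j : ℕ} (h : j ≠ i) (h' : j ≠ i + 1) :
      Joins (cross c i) (false, j) (true, j)
  | cross_down {c : C} {i : ℕ} : Joins (cross c i) (false, i) (true, i + 1)
  | cross_up {c : C} {i : ℕ} : Joins (cross c i) (false, i + 1) (true, i)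

end Layer

section Diagrams

variable {C : Type}

/-- The number of strands at the bottom of a list of layers under `m` strands; `none` if some layer
does not fit. -/
def bottomWidth : List (Layer C) → ℕ → Option ℕ
  | [], m => some m
  | ℓ :: D, m => (ℓ.next m).bind (bottomWidth D)

/-- The list `D` is a tangle diagram with `m` endpoints at the top and `n` at the bottom. For
`m = n = 0` it is a link diagram. -/
def IsTangle (m n : ℕ) (D : List (Layer C)) : Prop := bottomWidth D m = some n

/-- The points in which a link diagram (no endpoints) meets the horizontal lines between layers:
`(t, i)` is the `i`-th strand on the line below the first `t` layers. -/
def Point (D : List (Layer C)) : Type :=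
  {p : ℕ × ℕ // p.1 ≤ D.length ∧ ∃ w, bottomWidth (D.take p.1) 0 = some w ∧ p.2 < w}

/-- Two points are adjacent if an arc inside one layer runs from one to the other. -/
def Adjacent (D : List (Layer C)) (p q : Point D) : Prop :=
  ∃ (t : ℕ) (ℓ : Layer C) (b b' : Bool), D[t]? = some ℓ ∧
    p.1.1 = t + b.toNat ∧ q.1.1 = t + b'.toNat ∧ ℓ.Joins (b, p.1.2) (b', q.1.2)

/-- The number of components of a link diagram (strands pass straight through crossings):
`Quot` divides by the equivalence relation that adjacency generates. -/
noncomputable def numComponents (D : List (Layer C)) : ℕ := Nat.card (Quot (Adjacent D))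

end Diagrams

/-- A diagram: every crossing is resolved. The decoration `true` means that the overstrand of the
crossing has positive slope, `false` that it has negative slope. -/
abbrev Diagram : Type := List (Layer Bool)

/-- A pseudodiagram: a crossing is unresolved (`none`) or resolved. -/
abbrev PseudoDiagram : Type := List (Layer (Option Bool))

/-- A diagram, seen as a pseudodiagram. -/
def Diagram.toPseudo (D : Diagram) : PseudoDiagram := D.map (Layer.map some)

/-- The shadow of a diagram: all crossings become unresolved. -/
def Diagram.shadow (D : Diagram) : PseudoDiagram := D.map (Layer.map fun _ => none)

open Layer in
/-- The local moves. The first five generate the planar isotopies of diagrams, the others are the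
Reidemeister moves. -/
inductive LocalMove : Diagram → Diagram → Prop where
  /-- Straightening a bend `∩∪`. -/
  | zigzag_left (i : ℕ) : LocalMove [localMax i, localMin (i + 1)] []
  | zigzag_right (i : ℕ) : LocalMove [localMax (i + 1), localMin i] []
  /-- Two elementary pieces next to each other exchange their heights: `ℓ` is on the left, and
  `ℓ'` is `k` strands to the right of it. -/
  | exchange (ℓ ℓ' : Layer Bool) (k : ℕ) (h : ℓ'.pos = 0) :
      LocalMove [ℓ, ℓ'.shift (ℓ.pos + ℓ.outputs + k)] [ℓ'.shift (ℓ.pos + ℓ.inputs + k), ℓ]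
  /-- A strand that crosses one leg of a `∩` slides over or under the top to the other leg; the
  slope of the overstrand changes its sign. -/
  | slide_max (i : ℕ) (c : Bool) :
      LocalMove [localMax i, cross c (i + 1)] [localMax (i + 1), cross (!c) i]
  /-- The same for a `∪`. -/
  | slide_min (i : ℕ) (c : Bool) :
      LocalMove [cross c i, localMin (i + 1)] [cross (!c) (i + 1), localMin i]
  /-- First Reidemeister move. -/
  | r1_max (i : ℕ) (c : Bool) : LocalMove [localMax i, cross c i] [localMax i]
  | r1_min (i : ℕ) (c : Bool) : LocalMove [cross c i, localMin i] [localMin i]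
  /-- Second Reidemeister move. -/
  | r2 (i : ℕ) (c : Bool) : LocalMove [cross c i, cross (!c) i] []
  /-- Third Reidemeister move. Of the three strands, the first and the second meet in `a`, the
  first and the third in `b`, the second and the third in `c`; the condition says that one strand
  is on top and one at the bottom. -/
  | r3 (i : ℕ) (a b c : Bool) (h : b = a ∨ b = c) :
      LocalMove [cross a i, cross b (i + 1), cross c i]
        [cross c (i + 1), cross b i, cross a (i + 1)]

/-- One local move inside a tangle diagram with `m` upper and `n` lower endpoints. -/
def MoveStep (m n : ℕ) (D D' : Diagram) : Prop :=
  IsTangle m n D ∧ IsTangle m n D' ∧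
    ∃ A L L' B : Diagram, LocalMove L L' ∧ D = A ++ L ++ B ∧ D' = A ++ L' ++ B

/-- Equivalence of tangle diagrams with fixed endpoints: a finite sequence of Reidemeister moves and
planar isotopies, in both directions. For `m = n = 0` it is the equivalence of link diagrams. -/
def Equivalent (m n : ℕ) : Diagram → Diagram → Prop := Relation.EqvGen (MoveStep m n)

/-- A split link diagram: it consists of a nonempty link diagram `E`, drawn inside a circle that is
placed in some region of the nonempty link diagram `A ++ B`. -/
def IsSplit (D : Diagram) : Prop :=
  IsTangle 0 0 D ∧ ∃ (A E B : Diagram) (k : ℕ), D = A ++ E.map (Layer.shift k) ++ B ∧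
    E ≠ [] ∧ IsTangle 0 0 E ∧ A ++ B ≠ [] ∧ IsTangle 0 0 (A ++ B)

/-- A link diagram is splittable if it is equivalent to a split link diagram. -/
def Splittable (D : Diagram) : Prop := ∃ D' : Diagram, Equivalent 0 0 D D' ∧ IsSplit D'

/-! ### Rational tangles -/

section Rational

variable {C : Type}

/-- Twist the two bottom endpoints of a tangle with two upper and two lower endpoints. -/
def bottomTwist (T : List (Layer C)) (c : C) : List (Layer C) := T ++ [.cross c 0]

/-- Twist the two right endpoints: a crossing is put to the right of `T`; its left corners are
joined to the two right endpoints of `T`. -/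
def rightTwist (T : List (Layer C)) (c : C) : List (Layer C) :=
  .localMax 1 :: (T ++ [.cross c 2, .localMin 1])

/-- Twist according to a list of syllables, alternating between the bottom endpoints (`true`) and
the right endpoints (`false`). A syllable is the list of its crossings. -/
def twistFrom : Bool → List (Layer C) → List (List C) → List (Layer C)
  | _, T, [] => T
  | true, T, s :: w => twistFrom false (s.foldl bottomTwist T) w
  | false, T, s :: w => twistFrom true (s.foldl rightTwist T) w

/-- Start with two vertical strands and twist, beginning with the bottom endpoints. -/
def twistWord (w : List (List C)) : List (Layer C) := twistFrom true [] w

end Rational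

/-- The rational tangle `(a₁, …, aₙ)`: the `i`-th syllable has `|aᵢ|` crossings, and the slope of
their overstrands has the sign of `aᵢ`. -/
def rationalTangle (w : List ℤ) : Diagram :=
  twistWord (w.map fun a => List.replicate a.natAbs (decide (0 < a)))

/-- The two ways to close a tangle with four endpoints. -/
inductive Closure : Type where
  /-- Join the top endpoints to each other and the bottom endpoints to each other. -/
  | numerator : Closure
  /-- Join the left endpoints to each other and the right endpoints to each other. -/
  | denominator : Closure

/-- The closure of a tangle diagram with two upper and two lower endpoints. -/
def Closure.close {C : Type} : Closure → List (Layer C) → List (Layer C)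
  | numerator, T => .localMax 0 :: (T ++ [.localMin 0])
  | denominator, T =>
      .localMax 0 :: .localMax 2 :: (T.map (Layer.shift 1) ++ [.localMin 0, .localMin 0])

/-- The number of crossings of a resolved syllable whose overstrand has positive slope, minus the
number of those whose overstrand has negative slope. -/
def signedCount (s : List Bool) : ℤ := (s.count true : ℤ) - (s.count false : ℤ)

/-! ### The Linking-Unlinking Game -/

/-- A turn: the player resolves one unresolved crossing, in one of the two ways. -/
def GameMove (P Q : PseudoDiagram) : Prop :=
  ∃ (A B : PseudoDiagram) (i : ℕ) (c : Bool),
    P = A ++ .cross none i :: B ∧ Q = A ++ .cross (some c) i :: B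

/-- The two roles. -/
inductive Role : Type where
  | linker : Role
  | unlinker : Role

/-- The role wins if the game ends with the link diagram `D`. -/
def Role.Wins : Role → Diagram → Prop
  | linker, D => ¬ Splittable D
  | unlinker, D => Splittable D

/-- The two players, by the order of play. -/
inductive Player : Type where
  | first : Player
  | second : Player

/-- A strategy: a response to each position. -/
abbrev Strategy : Type := PseudoDiagram → PseudoDiagram

/-- `σ.Reaches P₀ x P`: in the game on `P₀`, if the second player follows `σ`, then the first
player can play so that the position `P` occurs with player `x` to move. -/
inductive Strategy.Reaches (σ : Strategy) (P₀ : PseudoDiagram) : Player → PseudoDiagram → Prop where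
  | start : Reaches σ P₀ .first P₀
  | first {P Q : PseudoDiagram} (h : Reaches σ P₀ .first P) (hm : GameMove P Q) :
      Reaches σ P₀ .second Q
  | second {P : PseudoDiagram} (h : Reaches σ P₀ .second P) (hm : GameMove P (σ P)) :
      Reaches σ P₀ .first (σ P)

/-- The strategy always gives the second player a legal move, unless the game is over. -/
def Strategy.IsLegal (σ : Strategy) (P₀ : PseudoDiagram) : Prop :=
  ∀ P : PseudoDiagram, σ.Reaches P₀ .second P → (∃ Q, GameMove P Q) → GameMove P (σ P)

/-- `D` is the link diagram at the end of some play in which the second player follows `σ`. -/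
def Strategy.Outcome (σ : Strategy) (P₀ : PseudoDiagram) (D : Diagram) : Prop :=
  ∃ x : Player, σ.Reaches P₀ x D.toPseudo

/-- The strategy `σ` is winning for the second player in role `r` in the game on `P₀`. Each turn
uses up a crossing, so every play ends with a fully resolved diagram. -/
def Strategy.IsWinning (σ : Strategy) (r : Role) (P₀ : PseudoDiagram) : Prop :=
  σ.IsLegal P₀ ∧ ∀ D : Diagram, σ.Outcome P₀ D → r.Wins D

/-- The relation between the signs of the two syllables that the second player aims at: equal signs
as the Linker, opposite signs as the Unlinker. -/
def Role.relativeSign : Role → ℤ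
  | linker => 1
  | unlinker => -1

end LinkGame

open LinkGame

namespace LinkGame

/-! The second player treats the two twists as a pairing. Initially both have an odd number of
unresolved crossings and signed sum zero. If the first player leaves an unresolved crossing in the
twist just played, the answer is in the same twist with the opposite sign, which restores the sum.
If the move used up that twist, say with sign `ε`, both twists had odd counts and sum zero, so the
other twist still has a free crossing, and it is answered there with `δ` times that sign. From then
on both counts are even, and only answers of the first kind are needed. This is the invariant
`Balanced`, kept by `Balanced.exists_response` and turned into a strategy by `exists_strategy`.

At the end the two sums are `ε` and `δ * ε`. Opposite consecutive crossings of a twist cancel by a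
second Reidemeister move (`bottomTwist_cancel`, `rightTwist_cancel`), so the tangle reduces to `(ε,
δε)` by `equivalent_rationalTangle`. Its numerator closure is a Hopf link for `δ = 1` and a
two-component unlink for `δ = -1`; the latter is pulled apart explicitly in `splittable_unlink`.

The Hopf link is shown to be unsplittable by Fox 3-colourings. Their number is invariant under all
local moves and multiplicative on split diagrams, and every nonempty link diagram has at least the
three constant ones. A split diagram therefore has at least nine, whereas the Hopf link has fewer.

The denominator closure does not arise: joining the right endpoints makes the second twist
irrelevant to connectivity, and the odd first twist fuses everything into one component
(`numComponents_denominator_ne_two`). -/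

/-! ### Counting Fox 3-colourings -/

/-- Insert two equal entries into a sequence. -/
def insertTwo {α : Type} (i : ℕ) (c : α) (s : ℕ → α) : ℕ → α :=
  fun j => if j < i then s j else if j < i + 2 then c else s (j - 2)

/-- Delete two consecutive entries of a sequence. -/
def dropTwo {α : Type} (i : ℕ) (s : ℕ → α) : ℕ → α :=
  fun j => if j < i then s j else s (j + 2)

/-- The colours below a crossing in terms of the colours above it: the overstrand keeps its colour,
and the three colours at the crossing add up to zero. -/
def crossColors (c : Bool) (i : ℕ) (s : ℕ → ZMod 3) : ℕ → ZMod 3 :=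
  fun j => if j = i then (if c then s (i + 1) else -(s i + s (i + 1)))
    else if j = i + 1 then (if c then -(s i + s (i + 1)) else s i) else s j

/-- Pull a weight on colour sequences back through a layer, summing over all colourings of it. -/
def Layer.weigh : Layer Bool → ((ℕ → ZMod 3) → ℕ) → (ℕ → ZMod 3) → ℕ
  | localMax i, f => fun s => ∑ c, f (insertTwo i c s)
  | localMin i, f => fun s => if s i = s (i + 1) then f (dropTwo i s) else 0
  | cross c i, f => fun s => f (crossColors c i s)

/-- Pull a weight on colour sequences back through a diagram. -/
def weigh (D : Diagram) (f : (ℕ → ZMod 3) → ℕ) : (ℕ → ZMod 3) → ℕ := D.foldr Layer.weigh f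

/-- The number of Fox 3-colourings of a link diagram. -/
def colorCount (D : Diagram) : ℕ := weigh D (fun _ => 1) (fun _ => 0)

@[simp] theorem weigh_nil (f : (ℕ → ZMod 3) → ℕ) : weigh [] f = f := rfl

@[simp] theorem weigh_cons (ℓ : Layer Bool) (D : Diagram) (f : (ℕ → ZMod 3) → ℕ) :
    weigh (ℓ :: D) f = ℓ.weigh (weigh D f) := rfl

theorem weigh_append (A B : Diagram) (f : (ℕ → ZMod 3) → ℕ) :
    weigh (A ++ B) f = weigh A (weigh B f) := by simp [weigh]

/-- The two pieces touch disjoint positions, so their operations on colour sequences commute after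
the index shift caused by the left piece. -/
theorem weigh_exchange (ℓ ℓ' : Layer Bool) (k : ℕ) (h : ℓ'.pos = 0) (f : (ℕ → ZMod 3) → ℕ) :
    weigh [ℓ, ℓ'.shift (ℓ.pos + ℓ.outputs + k)] f =
      weigh [ℓ'.shift (ℓ.pos + ℓ.inputs + k), ℓ] f := by
  funext s
  have key : ∀ x y : ℕ → ZMod 3, x = y → f x = f y := fun _ _ h => by rw [h]
  cases ℓ with
  | localMax i =>
    cases ℓ' with
    | localMax i' =>
      simp only [Layer.pos] at h
      subst h
      simp only [weigh_cons, weigh_nil, Layer.weigh, Layer.shift, Layer.pos, Layer.inputs,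
        Layer.outputs]
      rw [Finset.sum_comm]
      refine Finset.sum_congr rfl fun a _ => Finset.sum_congr rfl fun b _ => key _ _ ?_
      funext j
      simp only [insertTwo]
      grind
    | localMin i' =>
      simp only [Layer.pos] at h
      subst h
      simp only [weigh_cons, weigh_nil, Layer.weigh, Layer.shift, Layer.pos, Layer.inputs,
        Layer.outputs]
      have e : ∀ c, insertTwo i c s (0 + (i + 2 + k)) = s (0 + (i + 0 + k)) := by
        intro c; simp only [insertTwo]; grind
      have e' : ∀ c, insertTwo i c s (0 + (i + 2 + k) + 1) = s (0 + (i + 0 + k) + 1) := by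
        intro c; simp only [insertTwo]; grind
      simp only [e, e']
      split_ifs
      · refine Finset.sum_congr rfl fun a _ => key _ _ ?_
        funext j
        simp only [insertTwo, dropTwo]
        grind
      · simp
    | cross c i' =>
      simp only [Layer.pos] at h
      subst h
      simp only [weigh_cons, weigh_nil, Layer.weigh, Layer.shift, Layer.pos, Layer.inputs,
        Layer.outputs]
      refine Finset.sum_congr rfl fun a _ => key _ _ ?_
      funext j
      simp only [insertTwo, crossColors]
      grind
  | localMin i =>
    cases ℓ' with
    | localMax i' =>
      simp only [Layer.pos] at h
      subst h
      simp only [weigh_cons, weigh_nil, Layer.weigh, Layer.shift, Layer.pos, Layer.inputs,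
        Layer.outputs]
      have e : ∀ c, insertTwo (0 + (i + 2 + k)) c s i = s i := by
        intro c; simp only [insertTwo]; grind
      have e' : ∀ c, insertTwo (0 + (i + 2 + k)) c s (i + 1) = s (i + 1) := by
        intro c; simp only [insertTwo]; grind
      simp only [e, e']
      split_ifs
      · refine Finset.sum_congr rfl fun a _ => key _ _ ?_
        funext j
        simp only [insertTwo, dropTwo]
        grind
      · simp
    | localMin i' =>
      simp only [Layer.pos] at h
      subst h
      simp only [weigh_cons, weigh_nil, Layer.weigh, Layer.shift, Layer.pos, Layer.inputs,
        Layer.outputs]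
      have e : dropTwo i (dropTwo (0 + (i + 2 + k)) s) = dropTwo (0 + (i + 0 + k)) (dropTwo i s) := by
        funext j
        simp only [dropTwo]
        grind
      rw [e]
      simp only [dropTwo]
      grind
    | cross c i' =>
      simp only [Layer.pos] at h
      subst h
      simp only [weigh_cons, weigh_nil, Layer.weigh, Layer.shift, Layer.pos, Layer.inputs,
        Layer.outputs]
      have e : dropTwo i (crossColors c (0 + (i + 2 + k)) s) =
          crossColors c (0 + (i + 0 + k)) (dropTwo i s) := by
        funext j
        simp only [dropTwo, crossColors]
        grind
      rw [e]
      simp only [crossColors]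
      grind
  | cross d i =>
    cases ℓ' with
    | localMax i' =>
      simp only [Layer.pos] at h
      subst h
      simp only [weigh_cons, weigh_nil, Layer.weigh, Layer.shift, Layer.pos, Layer.inputs,
        Layer.outputs]
      refine Finset.sum_congr rfl fun a _ => key _ _ ?_
      funext j
      simp only [insertTwo, crossColors]
      grind
    | localMin i' =>
      simp only [Layer.pos] at h
      subst h
      simp only [weigh_cons, weigh_nil, Layer.weigh, Layer.shift, Layer.pos, Layer.inputs,
        Layer.outputs]
      have e : crossColors d i (dropTwo (0 + (i + 2 + k)) s) =
          dropTwo (0 + (i + 2 + k)) (crossColors d i s) := by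
        funext j
        simp only [dropTwo, crossColors]
        grind
      rw [e]
      simp only [crossColors]
      grind
    | cross c i' =>
      simp only [Layer.pos] at h
      subst h
      simp only [weigh_cons, weigh_nil, Layer.weigh, Layer.shift, Layer.pos, Layer.inputs,
        Layer.outputs]
      refine key _ _ ?_
      funext j
      simp only [crossColors]
      grind

/-- Colours on the boundary of a move determine matching colourings of its two sides. Equality for
every weight `f`, and not only of total counts, is what lets the moves be applied inside a larger
diagram. -/
theorem LocalMove.weigh_eq {L L' : Diagram} (h : LocalMove L L') (f : (ℕ → ZMod 3) → ℕ) :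
    weigh L f = weigh L' f := by
  have key : ∀ x y : ℕ → ZMod 3, x = y → f x = f y := fun _ _ h => by rw [h]
  have h3 : ∀ x : ZMod 3, x + x + x = 0 := by decide
  cases h with
  | exchange ℓ ℓ' k h => exact weigh_exchange ℓ ℓ' k h f
  | zigzag_left i =>
    funext s
    simp only [weigh_cons, weigh_nil, Layer.weigh]
    have e : ∀ c, insertTwo i c s (i + 1) = c := by intro c; simp only [insertTwo]; grind
    have e' : ∀ c, insertTwo i c s (i + 1 + 1) = s i := by intro c; simp only [insertTwo]; grind
    simp only [e, e', Finset.sum_ite_eq', Finset.mem_univ, if_true]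
    refine key _ _ ?_
    funext j
    simp only [insertTwo, dropTwo]
    grind
  | zigzag_right i =>
    funext s
    simp only [weigh_cons, weigh_nil, Layer.weigh]
    have e : ∀ c, insertTwo (i + 1) c s (i + 1) = c := by intro c; simp only [insertTwo]; grind
    have e' : ∀ c, insertTwo (i + 1) c s i = s i := by intro c; simp only [insertTwo]; grind
    simp only [e, e', Finset.sum_ite_eq, Finset.mem_univ, if_true]
    refine key _ _ ?_
    funext j
    simp only [insertTwo, dropTwo]
    grind
  | slide_max i c =>
    funext s
    simp only [weigh_cons, weigh_nil, Layer.weigh]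
    cases c
    · refine Finset.sum_congr rfl fun a _ => key _ _ ?_
      funext j
      simp only [insertTwo, crossColors]
      grind
    -- Here the transverse strand is over, so the top of the arc changes colour from `a` to `-s i -
    -- a`. The sums agree after this reflection of the summation variable.
    · refine Fintype.sum_equiv (Equiv.subLeft (-s i)) _ _ fun a => key _ _ ?_
      funext j
      simp only [insertTwo, crossColors, Equiv.subLeft_apply]
      grind
  | slide_min i c =>
    funext s
    simp only [weigh_cons, weigh_nil, Layer.weigh]
    cases c
    · have e : (crossColors false i s (i + 1) = crossColors false i s (i + 1 + 1)) ↔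
          crossColors (!false) (i + 1) s i = crossColors (!false) (i + 1) s (i + 1) := by
        simp only [crossColors]
        grind
      -- The colour of the strand that survives the minimum agrees on both sides only under the
      -- matching condition, so the condition must be available when the sequences are compared.
      by_cases h : crossColors (!false) (i + 1) s i = crossColors (!false) (i + 1) s (i + 1)
      · rw [if_pos h, if_pos (e.2 h)]
        refine key _ _ ?_
        simp only [crossColors] at h
        funext j
        simp only [dropTwo, crossColors]
        grind
      · rw [if_neg h, if_neg (e.not.2 h)]
    · have e : (crossColors true i s (i + 1) = crossColors true i s (i + 1 + 1)) ↔
          crossColors (!true) (i + 1) s i = crossColors (!true) (i + 1) s (i + 1) := by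
        simp only [crossColors]
        grind
      by_cases h : crossColors (!true) (i + 1) s i = crossColors (!true) (i + 1) s (i + 1)
      · rw [if_pos h, if_pos (e.2 h)]
        refine key _ _ ?_
        simp only [crossColors] at h
        funext j
        simp only [dropTwo, crossColors]
        grind
      · rw [if_neg h, if_neg (e.not.2 h)]
  | r1_max i c =>
    funext s
    simp only [weigh_cons, weigh_nil, Layer.weigh]
    refine Finset.sum_congr rfl fun a _ => key _ _ ?_
    have := h3 a
    funext j
    simp only [insertTwo, crossColors]
    grind
  | r1_min i c =>
    funext s
    simp only [weigh_cons, weigh_nil, Layer.weigh]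
    have e : dropTwo i (crossColors c i s) = dropTwo i s := by
      funext j
      simp only [dropTwo, crossColors]
      grind
    rw [e]
    have : (crossColors c i s i = crossColors c i s (i + 1)) ↔ s i = s (i + 1) := by
      simp only [crossColors]
      have := h3 (s i)
      have := h3 (s (i + 1))
      grind
    simp only [this]
  | r2 i c =>
    funext s
    simp only [weigh_cons, weigh_nil, Layer.weigh]
    refine key _ _ ?_
    funext j
    simp only [crossColors]
    grind
  | r3 i a b c h =>
    funext s
    simp only [weigh_cons, weigh_nil, Layer.weigh]
    refine key _ _ ?_
    have := h3 (s i)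
    have := h3 (s (i+1))
    have := h3 (s (i+2))
    funext j
    simp only [crossColors]
    grind

theorem Equivalent.colorCount_eq {m n : ℕ} {D D' : Diagram} (h : Equivalent m n D D') :
    colorCount D = colorCount D' := by
  induction h with
  | rel _ _ h =>
    obtain ⟨-, -, A, L, L', B, hL, rfl, rfl⟩ := h
    simp only [colorCount, weigh_append, hL.weigh_eq]
  | refl => rfl
  | symm _ _ _ ih => exact ih.symm
  | trans _ _ _ _ _ ih ih' => exact ih.trans ih'

/-! ### Colourings of split diagrams -/

/-- The sequence `s` with the first `m` entries of `a` inserted at position `k`. -/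
def insertBlock (k m : ℕ) (a s : ℕ → ZMod 3) : ℕ → ZMod 3 :=
  fun j => if j < k then s j else if j < k + m then a (j - k) else s (j - m)

/-- The shifted layers act only on the inserted block. Since `E` ends with no strands, the block has
disappeared when `f` is reached, and `f` sees the untouched outer sequence `s`. The general `m` is
needed for the induction through the layers. -/
theorem weigh_shift (k : ℕ) (f : (ℕ → ZMod 3) → ℕ) (s : ℕ → ZMod 3) (E : Diagram) :
    ∀ (m : ℕ) (a : ℕ → ZMod 3), bottomWidth E m = some 0 →
      weigh (E.map (Layer.shift k)) f (insertBlock k m a s) = weigh E (fun _ => 1) a * f s := by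
  induction E with
  | nil =>
    intro m a h
    simp only [bottomWidth, Option.some.injEq] at h
    subst h
    have : insertBlock k 0 a s = s := by funext j; simp only [insertBlock]; grind
    simp [this]
  | cons ℓ E ih =>
    intro m a h
    obtain ⟨m', hm, h⟩ := Option.bind_eq_some_iff.1 h
    cases ℓ with
    | localMax i =>
      simp only [Layer.next] at hm
      split_ifs at hm with hi
      cases hm
      simp only [List.map_cons, Layer.shift, weigh_cons, Layer.weigh, Finset.sum_mul]
      refine Finset.sum_congr rfl fun c _ => ?_
      rw [← ih _ _ h]
      congr 1
      funext j
      simp only [insertTwo, insertBlock]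
      grind
    | localMin i =>
      simp only [Layer.next] at hm
      split_ifs at hm with hi
      cases hm
      simp only [List.map_cons, Layer.shift, weigh_cons, Layer.weigh]
      have e : insertBlock k m a s (i + k) = a i := by simp only [insertBlock]; grind
      have e' : insertBlock k m a s (i + k + 1) = a (i + 1) := by simp only [insertBlock]; grind
      rw [e, e']
      split_ifs
      · rw [← ih _ _ h]
        congr 1
        funext j
        simp only [dropTwo, insertBlock]
        grind
      · simp
    | cross c i =>
      simp only [Layer.next] at hm
      split_ifs at hm with hi
      cases hm
      simp only [List.map_cons, Layer.shift, weigh_cons, Layer.weigh]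
      rw [← ih _ _ h]
      congr 1
      funext j
      simp only [crossColors, insertBlock]
      grind

theorem weigh_mul (D : Diagram) (n : ℕ) (f : (ℕ → ZMod 3) → ℕ) :
    weigh D (fun s => n * f s) = fun s => n * weigh D f s := by
  induction D with
  | nil => rfl
  | cons ℓ D ih =>
    simp only [weigh_cons, ih]
    funext s
    cases ℓ with
    | localMax i => simp only [Layer.weigh, Finset.mul_sum]
    | localMin i => simp only [Layer.weigh, mul_ite, mul_zero]
    | cross c i => rfl

/-- A monochromatic colouring always extends monochromatically: take colour `c` at each maximum, and
note that `-(c + c) = c` modulo 3 at each crossing. -/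
theorem one_le_weigh (D : Diagram) (n : ℕ) (c : ZMod 3) :
    ∀ (m : ℕ) (s : ℕ → ZMod 3), bottomWidth D m = some n → (∀ j < m, s j = c) →
      1 ≤ weigh D (fun _ => 1) s := by
  induction D with
  | nil => intro m s _ _; simp
  | cons ℓ D ih =>
    intro m s h hs
    obtain ⟨m', hm, h⟩ := Option.bind_eq_some_iff.1 h
    cases ℓ with
    | localMax i =>
      simp only [Layer.next] at hm
      split_ifs at hm with hi
      cases hm
      simp only [weigh_cons, Layer.weigh]
      refine le_trans (ih _ (insertTwo i c s) h ?_) (Finset.single_le_sum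
        (f := fun c => weigh D (fun _ => 1) (insertTwo i c s)) (fun _ _ => Nat.zero_le _)
        (Finset.mem_univ c))
      intro j hj
      simp only [insertTwo]
      grind
    | localMin i =>
      simp only [Layer.next] at hm
      split_ifs at hm with hi
      cases hm
      simp only [weigh_cons, Layer.weigh]
      rw [if_pos (by rw [hs _ (by omega), hs _ (by omega)])]
      refine ih _ _ h ?_
      intro j hj
      simp only [dropTwo]
      grind
    | cross d i =>
      simp only [Layer.next] at hm
      split_ifs at hm with hi
      cases hm
      simp only [weigh_cons, Layer.weigh]
      refine ih _ _ h ?_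
      have h3 : ∀ x : ZMod 3, -(x + x) = x := by decide
      intro j hj
      simp only [crossColors, hs i (by omega), hs (i + 1) (by omega), h3]
      grind

/-- With no strands above it, the first layer must be a maximum. Each of its three colours extends
to a constant colouring. -/
theorem three_le_colorCount {D : Diagram} (hD : D ≠ []) (h : IsTangle 0 0 D) :
    3 ≤ colorCount D := by
  cases D with
  | nil => exact absurd rfl hD
  | cons ℓ D =>
    obtain ⟨m', hm, h⟩ := Option.bind_eq_some_iff.1 h
    cases ℓ with
    | localMax i =>
      simp only [Layer.next] at hm
      split_ifs at hm with hi
      cases hm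
      simp only [colorCount, weigh_cons, Layer.weigh]
      calc 3 = ∑ _c : ZMod 3, 1 := by simp
        _ ≤ _ := Finset.sum_le_sum fun c _ => one_le_weigh D 0 c _ _ h ?_
      intro j hj
      simp only [insertTwo]
      grind
    | localMin i => simp [Layer.next] at hm
    | cross c i => simp [Layer.next] at hm

theorem IsSplit.nine_le_colorCount {D : Diagram} (h : IsSplit D) : 9 ≤ colorCount D := by
  obtain ⟨-, A, E, B, k, rfl, hE, hE', hAB, hAB'⟩ := h
  have : colorCount (A ++ E.map (Layer.shift k) ++ B) = colorCount E * colorCount (A ++ B) := by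
    have e : weigh (E.map (Layer.shift k)) (weigh B fun _ => 1) =
        fun s => colorCount E * weigh B (fun _ => 1) s := by
      funext s
      rw [colorCount, ← weigh_shift k _ s E 0 _ hE']
      congr 1
      funext j
      simp only [insertBlock]
      grind
    rw [colorCount, weigh_append, weigh_append, e, weigh_mul, ← weigh_append, colorCount,
      colorCount]
  rw [this]
  exact Nat.mul_le_mul (three_le_colorCount hE hE') (three_le_colorCount hAB hAB')

theorem not_splittable_of_colorCount_lt {D : Diagram} (h : colorCount D < 9) : ¬ Splittable D := by
  rintro ⟨D', hD, hD'⟩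
  exact absurd hD'.nine_le_colorCount (by rw [← hD.colorCount_eq]; omega)

/-- The Hopf link is not splittable. -/
theorem not_splittable_hopf (c : Bool) :
    ¬ Splittable (Closure.numerator.close (twistWord [[c], [c]])) := by
  refine not_splittable_of_colorCount_lt ?_
  -- The Hopf link has determinant 2, a unit modulo 3, so only the constant colourings occur. The
  -- computation runs over the colours of the two maxima.
  cases c <;> decide

/-! ### Equivalences of tangle diagrams -/

section Widths

variable {C : Type}

theorem bottomWidth_append (A B : List (Layer C)) (m : ℕ) :
    bottomWidth (A ++ B) m = (bottomWidth A m).bind (bottomWidth B) := by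
  induction A generalizing m with
  | nil => rfl
  | cons ℓ A ih =>
    simp only [List.cons_append, bottomWidth]
    cases ℓ.next m with
    | none => rfl
    | some w => exact ih w

theorem IsTangle.append {A B : List (Layer C)} {m n p : ℕ} (hA : IsTangle m n A)
    (hB : IsTangle n p B) : IsTangle m p (A ++ B) := by
  unfold IsTangle at *
  rw [bottomWidth_append, hA]
  exact hB

theorem Layer.next_add {ℓ : Layer C} {m n : ℕ} (h : ℓ.next m = some n) (k : ℕ) :
    ℓ.next (m + k) = some (n + k) := by
  cases ℓ <;> simp only [Layer.next] at h ⊢ <;> grind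

theorem IsTangle.add {A : List (Layer C)} {m n : ℕ} (h : IsTangle m n A) (k : ℕ) :
    IsTangle (m + k) (n + k) A := by
  induction A generalizing m with
  | nil =>
    simp only [IsTangle, bottomWidth, Option.some.injEq] at h ⊢
    omega
  | cons ℓ A ih =>
    obtain ⟨w, hw, h⟩ := Option.bind_eq_some_iff.1 h
    exact Option.bind_eq_some_iff.2 ⟨w + k, Layer.next_add hw k, ih h⟩

end Widths

theorem LocalMove.equivalent {m n : ℕ} {L L' : Diagram} (h : LocalMove L L')
    (hL : IsTangle m n L) (hL' : IsTangle m n L') : Equivalent m n L L' :=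
  .rel _ _ ⟨hL, hL', [], L, L', [], h, by simp, by simp⟩

namespace Equivalent

variable {m n p q : ℕ} {D D' D'' : Diagram}

theorem refl (D : Diagram) : Equivalent m n D D := Relation.EqvGen.refl D

theorem symm (h : Equivalent m n D D') : Equivalent m n D' D := Relation.EqvGen.symm _ _ h

theorem trans (h : Equivalent m n D D') (h' : Equivalent m n D' D'') : Equivalent m n D D'' :=
  Relation.EqvGen.trans _ _ _ h h'

/-- Equivalent parts of a diagram can be exchanged, next to `k` further strands on the right. -/
theorem context (h : Equivalent m n D D') (k : ℕ) {A B : Diagram} (hA : IsTangle p (m + k) A)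
    (hB : IsTangle (n + k) q B) : Equivalent p q (A ++ D ++ B) (A ++ D' ++ B) := by
  induction h with
  | rel _ _ h =>
    obtain ⟨hD, hD', A', L, L', B', hL, rfl, rfl⟩ := h
    exact .rel _ _ ⟨(hA.append (hD.add k)).append hB, (hA.append (hD'.add k)).append hB,
      A ++ A', L, L', B' ++ B, hL, by simp, by simp⟩
  | refl => exact refl _
  | symm _ _ _ ih => exact ih.symm
  | trans _ _ _ _ _ ih ih' => exact ih.trans ih'

theorem append_left (h : Equivalent m n D D') {A : Diagram} (hA : IsTangle p m A) :
    Equivalent p n (A ++ D) (A ++ D') := by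
  simpa using h.context 0 hA (B := []) (q := n) rfl

theorem append_right (h : Equivalent m n D D') {B : Diagram} (hB : IsTangle n q B) :
    Equivalent m q (D ++ B) (D' ++ B) := by
  simpa using h.context 0 (A := []) (p := m) rfl hB

/-- A chain link: rewrite a part of a diagram by a local move. -/
theorem step {A L L' B : Diagram} (h : LocalMove L L') (hD : IsTangle m n (A ++ L ++ B))
    (hD' : IsTangle m n (A ++ L' ++ B)) : Equivalent m n (A ++ L ++ B) (A ++ L' ++ B) :=
  .rel _ _ ⟨hD, hD', A, L, L', B, h, rfl, rfl⟩

end Equivalent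

/-- A layer whose nontrivial part is to the right of a tangle can be moved from below the tangle to
above it. -/
theorem equivalent_comm (ℓ' : Layer Bool) (hℓ' : ℓ'.pos = 0) (k : ℕ) {T : Diagram} {m n : ℕ}
    (hT : IsTangle m n T) :
    Equivalent (m + k + ℓ'.inputs) (n + k + ℓ'.outputs) (T ++ [ℓ'.shift (n + k)])
      (ℓ'.shift (m + k) :: T) := by
  induction T generalizing m with
  | nil =>
    simp only [IsTangle, bottomWidth, Option.some.injEq] at hT
    subst hT
    exact .refl _
  | cons ℓ T ih =>
    obtain ⟨w, hw, hT⟩ := Option.bind_eq_some_iff.1 hT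
    have hℓ : IsTangle m w [ℓ] := Option.bind_eq_some_iff.2 ⟨w, hw, rfl⟩
    have hsh : ∀ w, IsTangle (w + k + ℓ'.inputs) (w + k + ℓ'.outputs) [ℓ'.shift (w + k)] := by
      intro w
      cases ℓ' <;> simp only [Layer.pos] at hℓ' <;> subst hℓ' <;>
        simp [IsTangle, bottomWidth, Layer.next, Layer.shift, Layer.inputs, Layer.outputs]
    have hadd : ∀ {A : Diagram} {a b : ℕ}, IsTangle a b A → ∀ j,
        IsTangle (a + k + j) (b + k + j) A := fun h j => (h.add k).add j
    have h1 := (ih hT).append_left (hadd hℓ ℓ'.inputs)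
    have hpos : ℓ.pos + ℓ.inputs ≤ m ∧ w + ℓ.inputs = m + ℓ.outputs := by
      cases ℓ <;> simp only [Layer.next, Layer.pos, Layer.inputs, Layer.outputs] at hw ⊢ <;> grind
    have hmove : LocalMove [ℓ, ℓ'.shift (w + k)] [ℓ'.shift (m + k), ℓ] := by
      -- The gap is the number of strands between the two pieces; `hpos` ensures that the
      -- subtraction is not truncated.
      have := LocalMove.exchange ℓ ℓ' (m + k - (ℓ.pos + ℓ.inputs)) hℓ'
      rwa [show ℓ.pos + ℓ.outputs + (m + k - (ℓ.pos + ℓ.inputs)) = w + k by omega,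
        show ℓ.pos + ℓ.inputs + (m + k - (ℓ.pos + ℓ.inputs)) = m + k by omega] at this
    have h2 := (hmove.equivalent ((hadd hℓ _).append (hsh w))
      ((hsh m).append (hadd hℓ _))).append_right (hadd hT _)
    exact h1.trans h2

/-! ### Cancellation of opposite twists -/

theorem isTangle_rightTwist {T : Diagram} (hT : IsTangle 2 2 T) (c : Bool) :
    IsTangle 2 2 (rightTwist T c) :=
  IsTangle.append (A := [.localMax 1]) (n := 4) rfl ((hT.add 2).append rfl)

theorem isTangle_bottomTwist {T : Diagram} (hT : IsTangle 2 2 T) (c : Bool) :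
    IsTangle 2 2 (bottomTwist T c) := hT.append rfl

theorem Equivalent.rightTwist {T T' : Diagram} (h : Equivalent 2 2 T T') (c : Bool) :
    Equivalent 2 2 (rightTwist T c) (rightTwist T' c) :=
  h.context (p := 2) (q := 2) 2 (A := [.localMax 1]) (B := [.cross c 2, .localMin 1]) rfl rfl

theorem Equivalent.bottomTwist {T T' : Diagram} (h : Equivalent 2 2 T T') (c : Bool) :
    Equivalent 2 2 (bottomTwist T c) (bottomTwist T' c) := h.append_right rfl

theorem bottomTwist_cancel {T : Diagram} (hT : IsTangle 2 2 T) (c : Bool) :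
    Equivalent 2 2 (bottomTwist (bottomTwist T c) (!c)) T := by
  have h := ((LocalMove.r2 0 c).equivalent (m := 2) (n := 2) rfl rfl).append_left hT
  simpa [LinkGame.bottomTwist] using h

/-- Unlike for bottom twists, the two crossings are separated by a minimum, and their maxima lie
above `T`. Isotopies first bring the crossings together below `T`; after the second Reidemeister
move, the remaining bends are straightened around `T`. -/
theorem rightTwist_cancel {T : Diagram} (hT : IsTangle 2 2 T) (c : Bool) :
    Equivalent 2 2 (rightTwist (rightTwist T c) (!c)) T := by
  let W : Diagram := [.cross c 2, .localMin 1, .cross (!c) 2, .localMin 1]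
  have hW : IsTangle 6 2 W := rfl
  -- One of the two maxima is placed to the right of the other, so that it can be pushed down past
  -- `T`.
  have h0 : Equivalent 2 6 [.localMax 1, .localMax 1] [.localMax 1, .localMax 3] :=
    (LocalMove.equivalent (m := 2) (n := 6)
      (.exchange (.localMax 1) (.localMax 0) 0 rfl) rfl rfl).symm
  have h1 := (equivalent_comm (.localMax 0) rfl 1 hT).symm
  -- Sliding one crossing along the maximum and the other along a minimum puts both at position 3
  -- with opposite signs. They cancel, and a zigzag leaves a single minimum.
  have h2 : Equivalent 4 2 (.localMax 3 :: W) [.localMin 2] := by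
    have slide : Equivalent 4 6 [.localMax 3, .cross c 2] [.localMax 2, .cross (!c) 3] := by
      have h := LocalMove.slide_max 2 (!c)
      rw [Bool.not_not] at h
      exact (h.equivalent (m := 4) (n := 6) rfl rfl).symm
    have s1 := slide.append_right (B := [.localMin 1, .cross (!c) 2, .localMin 1]) (q := 2) rfl
    have s2 := Equivalent.step (m := 4) (n := 2) (A := [.localMax 2, .cross (!c) 3])
      (B := [.localMin 1]) (.exchange (.localMin 1) (.cross (!c) 0) 1 rfl) rfl rfl
    have s3 := Equivalent.step (m := 4) (n := 2)
      (A := [.localMax 2, .cross (!c) 3, .cross (!c) 4])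
      (B := []) (.exchange (.localMin 1) (.localMin 0) 0 rfl) rfl rfl
    have s4 := Equivalent.step (m := 4) (n := 2) (A := [.localMax 2, .cross (!c) 3])
      (B := [.localMin 1]) (.slide_min 3 c) rfl rfl
    have r2 : Equivalent 6 6 [.cross (!c) 3, .cross c 3] [] := by
      have h := LocalMove.r2 3 (!c)
      rw [Bool.not_not] at h
      exact h.equivalent rfl rfl
    have s5 := r2.context (p := 4) (q := 2) 0 (A := [.localMax 2])
      (B := [.localMin 4, .localMin 1]) rfl rfl
    have s6 := Equivalent.step (m := 4) (n := 2) (A := []) (B := [.localMin 1])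
      (.exchange (.localMax 2) (.localMin 0) 0 rfl) rfl rfl
    have s7 := Equivalent.step (m := 4) (n := 2) (A := [.localMin 2]) (B := [])
      (.zigzag_right 1) rfl rfl
    exact s1.trans (s2.trans (s3.trans (s4.symm.trans (s5.trans (s6.trans s7)))))
  have h3 := equivalent_comm (.localMin 0) rfl 0 hT
  have h4 : Equivalent 2 2 [.localMax 1, .localMin 2] [] :=
    LocalMove.equivalent (.zigzag_left 1) rfl rfl
  have e0 := h0.append_right ((hT.add 4).append hW)
  have e1 := h1.context (p := 2) (q := 2) 1 (A := [.localMax 1]) (B := W) rfl rfl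
  have e2 := h2.append_left (p := 2) (A := .localMax 1 :: T)
    (IsTangle.append (A := [.localMax 1]) (n := 4) rfl (hT.add 2))
  have e3 := h3.append_left (p := 2) (A := [.localMax 1]) rfl
  have e4 := h4.append_right hT
  simp only [Layer.shift, W, List.append_assoc, List.cons_append, List.nil_append,
    Nat.zero_add, Nat.add_zero, Nat.reduceAdd] at e0 e1 e2 e3 e4
  simp only [LinkGame.rightTwist, List.append_assoc, List.cons_append, List.nil_append]
  exact e0.trans (e1.trans (e2.trans (e3.trans e4)))

/-! ### Reduction of rational tangles with two syllables -/

/-- A word in two letters is constant or contains two different consecutive letters. -/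
theorem eq_replicate_or_exists_not (s : List Bool) :
    (∃ n c, s = List.replicate n c) ∨ ∃ x c y, s = x ++ c :: (!c) :: y := by
  induction s with
  | nil => exact .inl ⟨0, true, rfl⟩
  | cons a s ih =>
    rcases ih with ⟨n, c, rfl⟩ | ⟨x, c, y, rfl⟩
    · by_cases h : c = a
      · exact .inl ⟨n + 1, c, by rw [h]; rfl⟩
      · obtain rfl : c = !a := by cases c <;> cases a <;> simp_all
        cases n with
        | zero => exact .inl ⟨1, a, rfl⟩
        | succ n => exact .inr ⟨[], a, List.replicate n (!a), rfl⟩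
    · exact .inr ⟨a :: x, c, y, rfl⟩

theorem signedCount_append (x y : List Bool) :
    signedCount (x ++ y) = signedCount x + signedCount y := by
  simp only [signedCount, List.count_append]
  push_cast
  ring

/-- The word of a syllable with a given signed count and no cancellation. -/
def reducedSyllable (a : ℤ) : List Bool := List.replicate a.natAbs (decide (0 < a))

/-- If cancelling `c` against `!c` preserves the class of a family of tangles, then a syllable can
be reduced. -/
theorem equivalent_reducedSyllable {m n : ℕ} (F : List Bool → Diagram)
    (hF : ∀ x c y, Equivalent m n (F (x ++ c :: (!c) :: y)) (F (x ++ y))) (s : List Bool) :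
    Equivalent m n (F s) (F (reducedSyllable (signedCount s))) := by
  induction h : s.length using Nat.strong_induction_on generalizing s with
  | _ l ih =>
    rcases eq_replicate_or_exists_not s with ⟨k, c, rfl⟩ | ⟨x, c, y, rfl⟩
    · have : reducedSyllable (signedCount (List.replicate k c)) = List.replicate k c := by
        cases c
        · simp [reducedSyllable, signedCount, List.count_replicate]
        -- For `k = 0` the sign test gives `false` instead of `true`, which is harmless because the
        -- syllable is empty.
        · cases k <;> simp [reducedSyllable, signedCount, List.count_replicate]
          omega
      rw [this]
      exact .refl _
    · have hc : signedCount (x ++ c :: (!c) :: y) = signedCount (x ++ y) := by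
        rw [signedCount_append, signedCount_append, add_right_inj]
        cases c <;> simp [signedCount]
      rw [hc]
      exact (hF x c y).trans (ih _ (by rw [← h]; simp) _ rfl)

theorem isTangle_foldl {f : Diagram → Bool → Diagram}
    (hf : ∀ T c, IsTangle 2 2 T → IsTangle 2 2 (f T c)) (s : List Bool) {T : Diagram}
    (hT : IsTangle 2 2 T) : IsTangle 2 2 (s.foldl f T) := by
  induction s generalizing T with
  | nil => exact hT
  | cons c s ih => exact ih (hf T c hT)

theorem Equivalent.foldl {f : Diagram → Bool → Diagram}
    (hf : ∀ T T' c, Equivalent 2 2 T T' → Equivalent 2 2 (f T c) (f T' c)) (s : List Bool)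
    {T T' : Diagram} (h : Equivalent 2 2 T T') : Equivalent 2 2 (s.foldl f T) (s.foldl f T') := by
  induction s generalizing T T' with
  | nil => exact h
  | cons c s ih => exact ih (hf T T' c h)

/-- The first syllable is reduced underneath the unreduced second one, which is possible because
right twisting respects equivalence. The second is then reduced over the already reduced first. -/
theorem equivalent_rationalTangle (u v : List Bool) :
    Equivalent 2 2 (twistWord [u, v]) (rationalTangle [signedCount u, signedCount v]) := by
  have hT : ∀ u : List Bool, IsTangle 2 2 (u.foldl bottomTwist []) := fun u =>
    isTangle_foldl (fun _ c h => isTangle_bottomTwist h c) u rfl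
  have h1 := equivalent_reducedSyllable (m := 2) (n := 2)
    (fun s => v.foldl rightTwist (s.foldl bottomTwist [])) (fun x c y => by
      simp only [List.foldl_append, List.foldl_cons]
      exact Equivalent.foldl (fun _ _ c h => h.rightTwist c) v
        (Equivalent.foldl (fun _ _ c h => h.bottomTwist c) y (bottomTwist_cancel (hT x) c))) u
  have h2 := equivalent_reducedSyllable (m := 2) (n := 2)
    (fun s => s.foldl rightTwist ((reducedSyllable (signedCount u)).foldl bottomTwist []))
    (fun x c y => by
      simp only [List.foldl_append, List.foldl_cons]
      exact Equivalent.foldl (fun _ _ c h => h.rightTwist c) y (rightTwist_cancel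
        (isTangle_foldl (fun _ c h => isTangle_rightTwist h c) x (hT _)) c)) v
  exact h1.trans h2

theorem Equivalent.close_numerator {T T' : Diagram} (h : Equivalent 2 2 T T') :
    Equivalent 0 0 (Closure.numerator.close T) (Closure.numerator.close T') :=
  h.context (p := 0) (q := 0) 0 (A := [.localMax 0]) (B := [.localMin 0]) rfl rfl

/-- The numerator closure of the tangle `(ε, -ε)` is the unlink. -/
theorem splittable_unlink (c : Bool) :
    Splittable (Closure.numerator.close (twistWord [[c], [!c]])) := by
  refine ⟨[.localMax 0, .localMin 0, .localMax 0, .localMin 0], ?_, rfl,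
    [.localMax 0, .localMin 0], [.localMax 0, .localMin 0], [], 0, rfl, by simp, rfl, by simp, rfl⟩
  -- Each crossing slides over one bend to position 1, where the two have opposite signs and cancel.
  -- Two circles remain, and the last exchange puts one above the other.
  have s1 := Equivalent.step (m := 0) (n := 0) (A := [.localMax 0, .localMax 1, .cross c 0])
    (B := [.localMin 0]) (.slide_min 1 c) rfl rfl
  have slide : Equivalent 2 4 [.localMax 1, .cross c 0] [.localMax 0, .cross (!c) 1] := by
    have h := LocalMove.slide_max 0 (!c)
    rw [Bool.not_not] at h
    exact (h.equivalent (m := 2) (n := 4) rfl rfl).symm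
  have s2 := slide.context (p := 0) (q := 0) 0 (A := [.localMax 0])
    (B := [.cross c 1, .localMin 2, .localMin 0]) rfl rfl
  have r2 : Equivalent 4 4 [.cross (!c) 1, .cross c 1] [] := by
    have h := LocalMove.r2 1 (!c)
    rw [Bool.not_not] at h
    exact h.equivalent rfl rfl
  have s3 := r2.context (p := 0) (q := 0) 0 (A := [.localMax 0, .localMax 0])
    (B := [.localMin 2, .localMin 0]) rfl rfl
  have s4 := Equivalent.step (m := 0) (n := 0) (A := [.localMax 0])
    (B := [.localMin 0]) (.exchange (.localMax 0) (.localMin 0) 0 rfl) rfl rfl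
  exact s1.symm.trans (s2.trans (s3.trans s4))

/-! ### The layers of a rational tangle with two syllables -/

section TwistWord

variable {C C' : Type}

theorem foldl_bottomTwist (u : List C) (T : List (Layer C)) :
    u.foldl bottomTwist T = T ++ u.map fun c => .cross c 0 := by
  induction u generalizing T with
  | nil => simp
  | cons c u ih => simp [ih, bottomTwist]

theorem foldl_rightTwist (v : List C) (T : List (Layer C)) :
    v.foldl rightTwist T = List.replicate v.length (.localMax 1) ++
      (T ++ v.flatMap fun c => [.cross c 2, .localMin 1]) := by
  induction v generalizing T with
  | nil => simp
  | cons c v ih =>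
    rw [List.foldl_cons, ih, List.length_cons, List.replicate_succ', rightTwist]
    simp

theorem twistWord_pair (u v : List C) :
    twistWord [u, v] = List.replicate v.length (.localMax 1) ++
      ((u.map fun c => .cross c 0) ++ v.flatMap fun c => [.cross c 2, .localMin 1]) := by
  simp only [twistWord, twistFrom, foldl_rightTwist, foldl_bottomTwist, List.nil_append]

end TwistWord

theorem Layer.next_shift {C : Type} {ℓ : Layer C} {m n : ℕ} (h : ℓ.next m = some n) (k : ℕ) :
    (ℓ.shift k).next (m + k) = some (n + k) := by
  cases ℓ <;> simp only [Layer.next, Layer.shift] at h ⊢ <;> grind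

theorem IsTangle.shift {C : Type} {A : List (Layer C)} {m n : ℕ} (h : IsTangle m n A) (k : ℕ) :
    IsTangle (m + k) (n + k) (A.map (Layer.shift k)) := by
  induction A generalizing m with
  | nil =>
    simp only [IsTangle, bottomWidth, Option.some.injEq] at h
    simp [IsTangle, bottomWidth, h]
  | cons ℓ A ih =>
    obtain ⟨w, hw, h⟩ := Option.bind_eq_some_iff.1 h
    exact Option.bind_eq_some_iff.2 ⟨w + k, Layer.next_shift hw k, ih h⟩

theorem IsTangle.close_denominator {C : Type} {T : List (Layer C)} (hT : IsTangle 2 2 T) :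
    IsTangle 0 0 (Closure.denominator.close T) :=
  IsTangle.append (A := [.localMax 0, .localMax 2]) (n := 4) rfl
    (((hT.shift 1).add 1).append (B := [.localMin 0, .localMin 0]) rfl)

/-! ### The denominator closure has one component -/

section Labels

variable {C α : Type}

/-- The labels `s` above a layer and `s'` below it are constant along the arcs inside the layer. -/
def Layer.Carries (ℓ : Layer C) (w w' : ℕ) (s s' : ℕ → α) : Prop :=
  ∀ (b b' : Bool) (i j : ℕ), ℓ.Joins (b, i) (b', j) → i < (bif b then w' else w) →
    j < (bif b' then w' else w) → (bif b then s' else s) i = (bif b' then s' else s) j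

/-- The labels `s t i` of the `i`-th strands on the `t`-th lines are constant along the arcs of a
list of layers that starts with `w` strands. -/
def Labels : List (Layer C) → ℕ → (ℕ → ℕ → α) → Prop
  | [], _, _ => True
  | ℓ :: D, w, s => ∃ w', ℓ.next w = some w' ∧ ℓ.Carries w w' (s 0) (s 1) ∧
      Labels D w' fun t => s (t + 1)

/-- All labels are equal to `e`. -/
def ConstLabels (e : α) : List (Layer C) → ℕ → (ℕ → ℕ → α) → Prop
  | [], w, s => ∀ i < w, s 0 i = e
  | ℓ :: D, w, s => (∀ i < w, s 0 i = e) ∧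
      ∀ w', ℓ.next w = some w' → ConstLabels e D w' fun t => s (t + 1)

theorem ConstLabels.eq {e : α} {D : List (Layer C)} {w : ℕ} {s : ℕ → ℕ → α}
    (h : ConstLabels e D w s) {t w' i : ℕ} (hw : bottomWidth (D.take t) w = some w')
    (hi : i < w') (ht : t ≤ D.length) : s t i = e := by
  induction D generalizing w s t with
  | nil =>
    simp only [List.length_nil, Nat.le_zero] at ht
    subst ht
    simp only [List.take_nil, bottomWidth, Option.some.injEq] at hw
    exact h i (hw ▸ hi)
  | cons ℓ D ih =>
    cases t with
    | zero =>
      simp only [List.take_zero, bottomWidth, Option.some.injEq] at hw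
      exact h.1 i (hw ▸ hi)
    | succ t =>
      obtain ⟨w₁, h₁, hw⟩ := Option.bind_eq_some_iff.1 hw
      exact ih (h.2 w₁ h₁) hw (by simpa using ht)

/-- A function on the points of a diagram that is constant along arcs is a labelling. -/
theorem exists_labels [Nonempty α] {D : List (Layer C)} (hD : IsTangle 0 0 D) (f : Point D → α)
    (hf : ∀ p q, Adjacent D p q → f p = f q) :
    ∃ s : ℕ → ℕ → α, Labels D 0 s ∧ ∀ p, f p = s p.1.1 p.1.2 := by
  classical
  -- Values off the diagram are arbitrary: `Layer.Carries` only compares labels of strands that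
  -- exist.
  let s : ℕ → ℕ → α := fun t i =>
    if h : t ≤ D.length ∧ ∃ w, bottomWidth (D.take t) 0 = some w ∧ i < w then f ⟨(t, i), h⟩
    else Classical.arbitrary α
  have key : ∀ (B A : List (Layer C)) (w n : ℕ), D = A ++ B → bottomWidth A 0 = some w →
      bottomWidth B w = some n → Labels B w fun t => s (t + A.length) := by
    intro B
    induction B with
    | nil => intro _ _ _ _ _ _; trivial
    | cons ℓ B ih =>
      intro A w n hAB hA hB
      obtain ⟨w', hw, hB⟩ := Option.bind_eq_some_iff.1 hB
      have hA' : bottomWidth (A ++ [ℓ]) 0 = some w' := by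
        rw [bottomWidth_append, hA]
        simp [bottomWidth, hw]
      have valid : ∀ (b : Bool) (i : ℕ), i < (bif b then w' else w) →
          A.length + b.toNat ≤ D.length ∧
            ∃ w, bottomWidth (D.take (A.length + b.toNat)) 0 = some w ∧ i < w := by
        intro b i hi
        cases b
        · exact ⟨by simp [hAB], w, by simpa [hAB] using hA, hi⟩
        · refine ⟨by simp [hAB], w', ?_, hi⟩
          rw [hAB, List.append_cons, Bool.toNat_true, ← List.length_singleton (a := ℓ),
            ← List.length_append, List.take_left]
          exact hA'
      refine ⟨w', hw, ?_, ?_⟩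
      · intro b b' i j hJ hi hj
        have e : ∀ (b : Bool) (i : ℕ) (hi : i < (bif b then w' else w)),
            (bif b then s (1 + A.length) else s (0 + A.length)) i = f ⟨(_, i), valid b i hi⟩ := by
          intro b i hi
          have : s (A.length + b.toNat) i = f ⟨(_, i), valid b i hi⟩ := dif_pos (valid b i hi)
          rw [← this]
          cases b <;> simp [add_comm]
        rw [e b i hi, e b' j hj]
        exact hf _ _ ⟨A.length, ℓ, b, b', by simp [hAB], rfl, rfl, hJ⟩
      · have := ih (A ++ [ℓ]) w' n (by simp [hAB]) hA' hB
        simpa [add_assoc, add_comm 1] using this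
  refine ⟨s, key D [] 0 0 rfl rfl hD, fun p => ?_⟩
  obtain ⟨⟨t, i⟩, h⟩ := p
  have e : s t i = f ⟨(t, i), h⟩ := dif_pos h
  exact e.symm

/-- Every labelling that starts with labels satisfying `Q` is constant. -/
def ForcesConst (α : Type) (D : List (Layer C)) (w : ℕ) (Q : (ℕ → α) → Prop) : Prop :=
  ∀ s : ℕ → ℕ → α, Labels D w s → Q (s 0) → ∃ e, ConstLabels e D w s

/-- The strands `2j` and `2j + 1` have the same labels, for `a ≤ j`. -/
def PairedFrom (a w : ℕ) (s : ℕ → α) : Prop :=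
  ∀ j, a ≤ j → 2 * j + 1 < w → s (2 * j) = s (2 * j + 1)

/-- A maximum inserted at an even position creates a new pair and moves the old pairs as wholes.
Every strand above continues below, so constancy passes upwards. -/
theorem ForcesConst.localMax {D : List (Layer C)} {w i : ℕ}
    (h : ForcesConst α D (2 * w + 2) (PairedFrom 0 (2 * w + 2))) :
    ForcesConst α (.localMax (2 * i) :: D) (2 * w) (PairedFrom 0 (2 * w)) := by
  rintro s ⟨w', hw', hc, hs⟩ hQ
  simp only [Layer.next] at hw'
  split_ifs at hw' with hi
  cases hw'
  have left : ∀ j < 2 * i, s 0 j = s 1 j := fun j hj =>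
    hc false true j j (.max_left hj) (by grind) (by grind)
  have right : ∀ j, 2 * i ≤ j → j < 2 * w → s 0 j = s 1 (j + 2) := fun j hj hj' =>
    hc false true j (j + 2) (.max_right hj) (by grind) (by grind)
  have turn : s 1 (2 * i) = s 1 (2 * i + 1) := hc true true _ _ .max_turn (by grind) (by grind)
  obtain ⟨e, he⟩ := h _ hs (by
    intro j _ hj
    simp only [Nat.zero_add]
    rcases lt_trichotomy j i with h | rfl | h
    · rw [← left _ (by omega), ← left _ (by omega)]
      exact hQ j (Nat.zero_le _) (by omega)
    · exact turn
    · obtain ⟨k, rfl⟩ : ∃ k, j = k + 1 := ⟨j - 1, by omega⟩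
      have h1 := right (2 * k) (by omega) (by omega)
      have h2 := right (2 * k + 1) (by omega) (by omega)
      rw [show 2 * (k + 1) = 2 * k + 2 by ring, ← h1, show 2 * k + 2 + 1 = 2 * k + 1 + 2 by ring,
        ← h2]
      exact hQ k (Nat.zero_le _) (by omega))
  refine ⟨e, fun j hj => ?_, fun w' hw' => ?_⟩
  · have : ∀ k < 2 * w + 2, s 1 k = e := by
      cases D with
      | nil => exact he
      | cons => exact he.1
    by_cases h : j < 2 * i
    · rw [left j h, this _ (by omega)]
    · rw [right j (by omega) hj, this _ (by omega)]
  · simp only [Layer.next, if_pos hi] at hw'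
    cases hw'
    exact he

/-- Without local maxima, constant labels stay constant. -/
theorem Labels.constLabels {D : List (Layer C)} (hD : ∀ i, .localMax i ∉ D) {w : ℕ}
    {s : ℕ → ℕ → α} (hs : Labels D w s) {e : α} (he : ∀ i < w, s 0 i = e) :
    ConstLabels e D w s := by
  induction D generalizing w s with
  | nil => exact he
  | cons ℓ D ih =>
    obtain ⟨w', hw, hc, hs⟩ := hs
    refine ⟨he, fun w'' hw'' => ?_⟩
    cases hw.symm.trans hw''
    refine ih (fun i h => hD i (List.mem_cons_of_mem _ h)) hs fun j hj => ?_
    simp only [Nat.zero_add]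
    cases ℓ with
    | localMax i => exact absurd List.mem_cons_self (hD i)
    | localMin i =>
      simp only [Layer.next] at hw
      split_ifs at hw with hi
      cases hw
      by_cases h : j < i
      · rw [← he j (by omega)]
        exact (hc false true j j (.min_left h) (by grind) (by grind)).symm
      · rw [← he (j + 2) (by omega)]
        exact (hc false true (j + 2) j (.min_right (by omega)) (by grind) (by grind)).symm
    | cross c i =>
      simp only [Layer.next] at hw
      split_ifs at hw with hi
      cases hw
      by_cases h : j = i
      · subst h
        rw [← he (j + 1) (by omega)]
        exact (hc false true (j + 1) j .cross_up (by grind) (by grind)).symm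
      · by_cases h' : j = i + 1
        · subst h'
          rw [← he i (by omega)]
          exact (hc false true i (i + 1) .cross_down (by grind) (by grind)).symm
        · rw [← he j (by omega)]
          exact (hc false true j j (.cross_fixed h h') (by grind) (by grind)).symm

theorem Labels.localMin {D : List (Layer C)} {w i : ℕ} {s : ℕ → ℕ → α}
    (hs : Labels (.localMin i :: D) (w + 2) s) :
    i ≤ w ∧ s 0 i = s 0 (i + 1) ∧ (∀ j < i, s 1 j = s 0 j) ∧
      (∀ j, i ≤ j → j < w → s 1 j = s 0 (j + 2)) ∧ Labels D w fun t => s (t + 1) := by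
  obtain ⟨w', hw, hc, hs⟩ := hs
  simp only [Layer.next] at hw
  split_ifs at hw with hi
  cases hw
  exact ⟨by omega, hc false false _ _ .min_turn (by grind) (by grind),
    fun j hj => (hc false true j j (.min_left hj) (by grind) (by grind)).symm,
    fun j hj hj' => (hc false true (j + 2) j (.min_right hj) (by grind) (by grind)).symm, hs⟩

theorem Labels.cross {D : List (Layer C)} {w i : ℕ} {c : C} {s : ℕ → ℕ → α}
    (hs : Labels (.cross c i :: D) w s) :
    i + 2 ≤ w ∧ s 1 i = s 0 (i + 1) ∧ s 1 (i + 1) = s 0 i ∧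
      (∀ j < w, j ≠ i → j ≠ i + 1 → s 1 j = s 0 j) ∧ Labels D w fun t => s (t + 1) := by
  obtain ⟨w', hw, hc, hs⟩ := hs
  simp only [Layer.next] at hw
  split_ifs at hw with hi
  cases hw
  exact ⟨hi, (hc false true _ _ .cross_up (by grind) (by grind)).symm,
    (hc false true _ _ .cross_down (by grind) (by grind)).symm,
    fun j hj h h' => (hc false true j j (.cross_fixed h h') (by grind) (by grind)).symm, hs⟩

theorem Labels.crosses {D : List (Layer C)} {w i : ℕ} (u : List C) {s : ℕ → ℕ → α}
    (hs : Labels ((u.map fun c => .cross c i) ++ D) w s) :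
    ∃ s' : ℕ → ℕ → α, Labels D w s' ∧
      (Odd u.length → s' 0 i = s 0 (i + 1) ∧ s' 0 (i + 1) = s 0 i) ∧
      (Even u.length → s' 0 i = s 0 i ∧ s' 0 (i + 1) = s 0 (i + 1)) ∧
      ∀ j < w, j ≠ i → j ≠ i + 1 → s' 0 j = s 0 j := by
  induction u generalizing s with
  | nil => exact ⟨s, hs, by simp, by simp, by simp⟩
  | cons c u ih =>
    obtain ⟨-, h1, h2, h3, hs⟩ := Labels.cross hs
    obtain ⟨s', hs', h4, h5, h6⟩ := ih hs
    refine ⟨s', hs', ?_, ?_, ?_⟩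
    · intro h
      rw [List.length_cons, Nat.odd_add_one, Nat.not_odd_iff_even] at h
      exact ⟨(h5 h).1.trans h1, (h5 h).2.trans h2⟩
    · intro h
      rw [List.length_cons, Nat.even_add_one, Nat.not_even_iff_odd] at h
      exact ⟨(h4 h).1.trans h2, (h4 h).2.trans h1⟩
    · exact fun j hj h h' => (h6 j hj h h').trans (h3 j hj h h')

/-- The crossing followed by the minimum joins strands 2 and 4 and moves strand 3 to position 2, so
it shortens the row of pairs by one without losing connectivity. The pair 2, 3 is not assumed, since
the first twist has disturbed it. -/
theorem Labels.right_crosses (v : List C) {s : ℕ → ℕ → α}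
    (hs : Labels ((v.flatMap fun c => [.cross c 3, .localMin 2]) ++ [.localMin 0, .localMin 0])
      (2 * v.length + 4) s) (hp : PairedFrom 2 (2 * v.length + 4) (s 0)) :
    s 0 0 = s 0 1 ∧ ∀ j, 2 ≤ j → j < 2 * v.length + 4 → s 0 j = s 0 2 := by
  induction v generalizing s with
  | nil =>
    obtain ⟨-, h1, -, h2, hs⟩ := Labels.localMin (w := 2) hs
    obtain ⟨-, h3, -⟩ := Labels.localMin (w := 0) hs
    refine ⟨h1, fun j hj hj' => ?_⟩
    have h4 := h2 0 (by omega) (by omega)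
    have h5 := h2 1 (by omega) (by omega)
    simp only [List.length_nil] at hj'
    obtain rfl | rfl : j = 2 ∨ j = 3 := by omega
    · rfl
    · simp only [Nat.zero_add, Nat.reduceAdd] at h3 h4 h5
      rw [← h4, ← h5, h3]
  | cons c v ih =>
    rw [List.flatMap_cons, List.append_assoc, List.length_cons] at hs
    obtain ⟨-, h1, h2, h3, hs⟩ := Labels.cross hs
    obtain ⟨-, h4, h5, h6, hs⟩ := Labels.localMin (w := 2 * v.length + 4) hs
    simp only [Nat.zero_add, Nat.reduceAdd, List.length_cons] at h1 h2 h3 h4 h5 h6 hs hp ⊢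
    have e0 : s 2 0 = s 0 0 := (h5 0 (by omega)).trans (h3 0 (by omega) (by omega) (by omega))
    have e1 : s 2 1 = s 0 1 := (h5 1 (by omega)).trans (h3 1 (by omega) (by omega) (by omega))
    have e2 : s 2 2 = s 0 3 := (h6 2 (by omega) (by omega)).trans h2
    have e24 : s 0 2 = s 0 4 := by rw [← h1, ← h4, h3 2 (by omega) (by omega) (by omega)]
    have e : ∀ j, 3 ≤ j → j < 2 * v.length + 4 → s 2 j = s 0 (j + 2) := fun j hj hj' =>
      (h6 j (by omega) hj').trans (h3 _ (by omega) (by omega) (by omega))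
    have e45 : s 0 4 = s 0 5 := hp 2 le_rfl (by omega)
    obtain ⟨h7, h8⟩ := ih hs (by
      intro j hj hj'
      have := hp (j + 1) (by omega) (by omega)
      simp only [Nat.reduceAdd]
      rw [e _ (by omega) (by omega), e _ (by omega) (by omega)]
      exact this)
    simp only [Nat.zero_add, Nat.reduceAdd] at h7 h8
    refine ⟨by rw [← e0, ← e1, h7], fun j hj hj' => ?_⟩
    -- After the crossing and the minimum, the old strands 3 and 5 occupy positions 2 and 3, which
    -- the induction hypothesis identifies.
    have h9 : s 0 5 = s 0 3 := by rw [← e2, ← h8 3 (by omega) (by omega), e 3 le_rfl (by omega)]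
    rcases (by omega : j = 2 ∨ j = 3 ∨ j = 4 ∨ 5 ≤ j) with rfl | rfl | rfl | h
    · rfl
    · rw [e24, e45, h9]
    · exact e24.symm
    · obtain ⟨k, rfl⟩ : ∃ k, j = k + 2 := ⟨j - 2, by omega⟩
      rw [← e k (by omega) (by omega), h8 k (by omega) (by omega), e2, e24, e45, h9]

/-- The map from points to components is itself a labelling constant along arcs. Every such
labelling is shown to be constant, so there cannot be two components. -/
theorem numComponents_denominator_ne_two (u v : List C) (hu : Odd u.length)
    (hD : IsTangle 0 0 (Closure.denominator.close (twistWord [u, v]))) :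
    numComponents (Closure.denominator.close (twistWord [u, v])) ≠ 2 := by
  intro h2
  set D := Closure.denominator.close (twistWord [u, v]) with hDdef
  let R : List (Layer C) := (u.map fun c => .cross c 1) ++
    ((v.flatMap fun c => [.cross c 3, .localMin 2]) ++ [.localMin 0, .localMin 0])
  have hclose : D = .localMax 0 :: .localMax 2 :: (List.replicate v.length (.localMax 2) ++ R) := by
    rw [hDdef, twistWord_pair]
    simp [Closure.close, R, Layer.shift, List.map_flatMap, Function.comp_def]
  have hR : ∀ α : Type,
      ForcesConst α R (2 * v.length + 4) (PairedFrom 0 (2 * v.length + 4)) := by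
    intro α s hs hp
    obtain ⟨s', hs', h1, -, h2⟩ := Labels.crosses u hs
    obtain ⟨h3, h4⟩ := Labels.right_crosses v hs' (by
      intro j hj hj'
      rw [h2 _ (by omega) (by omega) (by omega), h2 _ (by omega) (by omega) (by omega)]
      exact hp j (by omega) hj')
    -- Oddness enters here: the first twist interchanges strands 1 and 2, which links the pair 0, 1
    -- with the pair 2, 3.
    have h5 := h1 hu
    have h6 : s 0 0 = s 0 1 := hp 0 le_rfl (by omega)
    have h7 : s 0 2 = s 0 3 := hp 1 (by omega) (by omega)
    have h8 := h2 0 (by omega) (by omega) (by omega)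
    simp only [Nat.reduceAdd] at h5
    refine ⟨s 0 0, hs.constLabels (by simp [R]) fun j hj => ?_⟩
    rcases (by omega : j = 0 ∨ j = 1 ∨ j = 2 ∨ 3 ≤ j) with rfl | rfl | rfl | h
    · rfl
    · exact h6.symm
    · rw [← h8, h3, h5.1]
    · rw [← h2 j hj (by omega) (by omega), h4 j (by omega) hj, h5.2, h6]
  have hmax : ∀ (α : Type) (k w : ℕ),
      ForcesConst α R (2 * w + 2 * k) (PairedFrom 0 (2 * w + 2 * k)) →
      ForcesConst α (List.replicate k (.localMax 2) ++ R) (2 * w) (PairedFrom 0 (2 * w)) := by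
    intro α k
    induction k with
    | zero => exact fun w h => h
    | succ k ih =>
      intro w h
      exact ForcesConst.localMax (i := 1) (ih (w + 1)
        (by rwa [show 2 * (w + 1) + 2 * k = 2 * w + 2 * (k + 1) by ring]))
  have hF : ∀ α : Type, ForcesConst α D 0 (PairedFrom 0 0) := by
    intro α
    rw [hclose]
    refine ForcesConst.localMax (w := 0) (i := 0) (ForcesConst.localMax (w := 1) (i := 1)
      (hmax α v.length 2 ?_))
    rw [add_comm]
    exact hR α
  obtain ⟨x, y, hxy, -⟩ := Nat.card_eq_two_iff.1 h2
  have : Nonempty (Quot (Adjacent D)) := ⟨x⟩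
  obtain ⟨s, hs, hsp⟩ := exists_labels hD (Quot.mk (Adjacent D)) fun p q h => Quot.sound h
  obtain ⟨e, he⟩ := hF _ s hs (fun _ _ h => absurd h (by omega))
  have hall : ∀ x : Quot (Adjacent D), x = e := by
    intro x
    induction x using Quot.ind with
    | mk p =>
      obtain ⟨ht, w, hw, hi⟩ := p.2
      rw [hsp p]
      exact he.eq hw hi ht
  exact hxy ((hall x).trans (hall y).symm)

end Labels

/-! ### The game on the numerator closure -/

/-- The numerator closure of the tangle with syllables `u` and `v`. -/
abbrev numeratorClosure {C : Type} (u v : List C) : List (Layer C) :=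
  Closure.numerator.close (twistWord [u, v])

theorem numeratorClosure_eq {C : Type} (u v : List C) :
    numeratorClosure u v = (.localMax 0 :: List.replicate v.length (.localMax 1)) ++
      ((u.map fun c => .cross c 0) ++
        ((v.flatMap fun c => [.cross c 2, .localMin 1]) ++ [.localMin 0])) := by
  simp [numeratorClosure, Closure.close, twistWord_pair]

theorem map_numeratorClosure {C C' : Type} (f : C → C') (u v : List C) :
    (numeratorClosure u v).map (Layer.map f) = numeratorClosure (u.map f) (v.map f) := by
  simp [numeratorClosure_eq, Layer.map, List.map_flatMap, List.flatMap_map, Function.comp_def]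

theorem toPseudo_injective : Function.Injective Diagram.toPseudo := by
  refine List.map_injective_iff.2 fun ℓ ℓ' h => ?_
  cases ℓ <;> cases ℓ' <;> simp_all [Layer.map]

/-! ### Moves of the game as moves in a syllable -/

/-- One crossing of a syllable is resolved as `c`. -/
def SyllableMove (c : Bool) (u u' : List (Option Bool)) : Prop :=
  ∃ x y, u = x ++ none :: y ∧ u' = x ++ some c :: y

/-- The sum of the signs of the resolved crossings of a syllable. -/
def resolvedSum (u : List (Option Bool)) : ℤ := (u.count (some true) : ℤ) - u.count (some false)

/-- The sign of a resolved crossing. -/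
def crossingSign (c : Bool) : ℤ := bif c then 1 else -1

namespace SyllableMove

variable {c : Bool} {u u' : List (Option Bool)}

theorem length_eq (h : SyllableMove c u u') : u'.length = u.length := by
  obtain ⟨x, y, rfl, rfl⟩ := h
  simp

theorem count_none (h : SyllableMove c u u') : u.count none = u'.count none + 1 := by
  obtain ⟨x, y, rfl, rfl⟩ := h
  simp
  omega

theorem resolvedSum_eq (h : SyllableMove c u u') :
    resolvedSum u' = resolvedSum u + crossingSign c := by
  obtain ⟨x, y, rfl, rfl⟩ := h
  cases c <;> simp [resolvedSum, crossingSign] <;> ring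

theorem exists_of_count_pos (h : 0 < u.count none) (c : Bool) : ∃ u', SyllableMove c u u' := by
  obtain ⟨x, y, rfl⟩ := List.append_of_mem (List.count_pos_iff.1 h)
  exact ⟨_, x, y, rfl, rfl⟩

end SyllableMove

theorem GameMove.context {P Q : PseudoDiagram} (h : GameMove P Q) (A B : PseudoDiagram) :
    GameMove (A ++ (P ++ B)) (A ++ (Q ++ B)) := by
  obtain ⟨A', B', i, c, rfl, rfl⟩ := h
  exact ⟨A ++ A', B' ++ B, i, c, by simp, by simp⟩

theorem GameMove.of_append {X Y Q : PseudoDiagram} (h : GameMove (X ++ Y) Q) :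
    (∃ X', GameMove X X' ∧ Q = X' ++ Y) ∨ ∃ Y', GameMove Y Y' ∧ Q = X ++ Y' := by
  obtain ⟨A, B, i, c, h, rfl⟩ := h
  rcases List.append_eq_append_iff.1 h with ⟨Z, rfl, rfl⟩ | ⟨Z, rfl, hZ⟩
  · exact .inr ⟨_, ⟨Z, B, i, c, rfl, rfl⟩, by simp⟩
  · cases Z with
    | nil =>
      rw [List.nil_append] at hZ
      exact .inr ⟨_, ⟨[], B, i, c, hZ.symm, rfl⟩, by simp⟩
    | cons z Z =>
      rw [List.cons_append, List.cons.injEq] at hZ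
      obtain ⟨rfl, rfl⟩ := hZ
      exact .inl ⟨_, ⟨A, Z, i, c, rfl, rfl⟩, by simp⟩

theorem not_gameMove_of_forall {P Q : PseudoDiagram} (h : ∀ i, .cross none i ∉ P) :
    ¬ GameMove P Q := by
  rintro ⟨A, B, i, c, rfl, rfl⟩
  exact h i (by simp)

theorem not_gameMove_toPseudo (D : Diagram) (Q : PseudoDiagram) : ¬ GameMove D.toPseudo Q := by
  refine not_gameMove_of_forall fun i h => ?_
  obtain ⟨ℓ, -, h⟩ := List.mem_map.1 h
  cases ℓ <;> simp [Layer.map] at h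

theorem SyllableMove.gameMove_map {c : Bool} {u u' : List (Option Bool)} (h : SyllableMove c u u') :
    GameMove (u.map fun c => .cross c 0) (u'.map fun c => .cross c 0) := by
  obtain ⟨x, y, rfl, rfl⟩ := h
  exact ⟨x.map fun c => .cross c 0, y.map fun c => .cross c 0, 0, c, by simp, by simp⟩

theorem SyllableMove.gameMove_flatMap {c : Bool} {u u' : List (Option Bool)}
    (h : SyllableMove c u u') :
    GameMove (u.flatMap fun c => [.cross c 2, .localMin 1])
      (u'.flatMap fun c => [.cross c 2, .localMin 1]) := by
  obtain ⟨x, y, rfl, rfl⟩ := h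
  exact ⟨x.flatMap fun c => [.cross c 2, .localMin 1],
    .localMin 1 :: y.flatMap fun c => [.cross c 2, .localMin 1], 2, c, by simp, by simp⟩

theorem SyllableMove.gameMove_left {c : Bool} {u u' : List (Option Bool)}
    (h : SyllableMove c u u') (v : List (Option Bool)) :
    GameMove (numeratorClosure u v) (numeratorClosure u' v) := by
  rw [numeratorClosure_eq, numeratorClosure_eq]
  exact h.gameMove_map.context _ _

theorem SyllableMove.gameMove_right {c : Bool} {v v' : List (Option Bool)}
    (h : SyllableMove c v v') (u : List (Option Bool)) :
    GameMove (numeratorClosure u v) (numeratorClosure u v') := by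
  rw [numeratorClosure_eq, numeratorClosure_eq, h.length_eq]
  have := (h.gameMove_flatMap.context (u.map fun c => .cross c 0) [.localMin 0]).context
    (.localMax 0 :: List.replicate v.length (.localMax 1)) []
  simpa using this

theorem exists_syllableMove_of_gameMove_map {u : List (Option Bool)} {Q : PseudoDiagram}
    (h : GameMove (u.map fun c => .cross c 0) Q) :
    ∃ c u', SyllableMove c u u' ∧ Q = u'.map fun c => .cross c 0 := by
  obtain ⟨A, B, i, c, h, rfl⟩ := h
  obtain ⟨x, y', rfl, rfl, h'⟩ := List.map_eq_append_iff.1 h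
  obtain ⟨a, y, rfl, ha, rfl⟩ := List.map_eq_cons_iff.1 h'
  cases ha
  exact ⟨c, _, ⟨x, y, rfl, rfl⟩, by simp⟩

theorem exists_syllableMove_of_gameMove_flatMap {v : List (Option Bool)} {Q : PseudoDiagram}
    (h : GameMove (v.flatMap fun c => [.cross c 2, .localMin 1]) Q) :
    ∃ c v', SyllableMove c v v' ∧ Q = v'.flatMap fun c => [.cross c 2, .localMin 1] := by
  induction v generalizing Q with
  | nil => exact absurd h (not_gameMove_of_forall (by simp))
  | cons a v ih =>
    rw [List.flatMap_cons] at h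
    rcases h.of_append with ⟨X', hX, rfl⟩ | ⟨Y', hY, rfl⟩
    · rcases GameMove.of_append (X := [.cross a 2]) (Y := [.localMin 1]) hX with
        ⟨Z, hZ, rfl⟩ | ⟨Z, hZ, rfl⟩
      · obtain ⟨A, B, i, c, hA, rfl⟩ := hZ
        cases A <;> simp at hA
        obtain ⟨⟨rfl, rfl⟩, rfl⟩ := hA
        exact ⟨c, _, ⟨[], v, rfl, rfl⟩, by simp⟩
      · exact absurd hZ (not_gameMove_of_forall (by simp))
    · obtain ⟨c, v', ⟨x, y, rfl, rfl⟩, rfl⟩ := ih hY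
      exact ⟨c, _, ⟨a :: x, y, rfl, rfl⟩, by simp⟩

/-- Unresolved crossings occur only in the two blocks coming from the syllables, so the game can be
analysed on pairs of words. -/
theorem GameMove.of_numeratorClosure {u v : List (Option Bool)} {Q : PseudoDiagram}
    (h : GameMove (numeratorClosure u v) Q) :
    (∃ c u', SyllableMove c u u' ∧ Q = numeratorClosure u' v) ∨
      ∃ c v', SyllableMove c v v' ∧ Q = numeratorClosure u v' := by
  rw [numeratorClosure_eq] at h
  rcases h.of_append with ⟨X, hX, rfl⟩ | ⟨X, hX, rfl⟩
  · exact absurd hX (not_gameMove_of_forall (by simp))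
  rcases hX.of_append with ⟨Y, hY, rfl⟩ | ⟨Y, hY, rfl⟩
  · obtain ⟨c, u', hu, rfl⟩ := exists_syllableMove_of_gameMove_map hY
    exact .inl ⟨c, u', hu, (numeratorClosure_eq _ _).symm⟩
  rcases hY.of_append with ⟨Z, hZ, rfl⟩ | ⟨Z, hZ, rfl⟩
  · obtain ⟨c, v', hv, rfl⟩ := exists_syllableMove_of_gameMove_flatMap hZ
    exact .inr ⟨c, v', hv, by rw [numeratorClosure_eq, hv.length_eq]⟩
  · exact absurd hZ (not_gameMove_of_forall (by simp))

/-! ### The strategy of the second player -/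

/-- The positions that the second player leaves to the first. -/
def Balanced (δ : ℤ) (u v : List (Option Bool)) : Prop :=
  (Odd (u.count none) ∧ Odd (v.count none) ∧ resolvedSum u = 0 ∧ resolvedSum v = 0) ∨
    (Even (u.count none) ∧ Even (v.count none) ∧
      ∃ ε : ℤ, (ε = 1 ∨ ε = -1) ∧ resolvedSum u = ε ∧ resolvedSum v = δ * ε)

/-- Replacing `ε` by `δ * ε` interchanges the two sums because `δ * δ = 1`. Hence only moves in the
first syllable have to be answered. -/
theorem Balanced.symm {δ : ℤ} (hδ : δ = 1 ∨ δ = -1) {u v : List (Option Bool)}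
    (h : Balanced δ u v) : Balanced δ v u := by
  rcases h with ⟨h1, h2, h3, h4⟩ | ⟨h1, h2, ε, h3, h4, h5⟩
  · exact .inl ⟨h2, h1, h4, h3⟩
  · refine .inr ⟨h2, h1, δ * ε, ?_, h5, ?_⟩ <;> rcases hδ with rfl | rfl <;>
      rcases h3 with rfl | rfl <;> simp [h4]

/-- The answer to a move in the first syllable. -/
theorem Balanced.exists_response {δ : ℤ} (hδ : δ = 1 ∨ δ = -1) {u u' v : List (Option Bool)}
    {c : Bool} (h : Balanced δ u v) (hu : SyllableMove c u u') :
    (∃ d u'', SyllableMove d u' u'' ∧ Balanced δ u'' v) ∨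
      ∃ d v', SyllableMove d v v' ∧ Balanced δ u' v' := by
  have hn := hu.count_none
  have hs := hu.resolvedSum_eq
  have hneg : crossingSign (!c) = -crossingSign c := by cases c <;> rfl
  -- The answer depends on whether the move used up its syllable. This can only happen in the odd
  -- state, where the other syllable still has a free crossing whose sign then fixes the relation of
  -- the two sums.
  rcases Nat.eq_zero_or_pos (u'.count none) with h0 | h0
  · rcases h with ⟨h1, h2, h3, h4⟩ | ⟨h1, h2, ε, h3, h4, h5⟩
    · obtain ⟨d, hd⟩ : ∃ d, crossingSign d = δ * crossingSign c := by
        rcases hδ with rfl | rfl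
        · exact ⟨c, by simp⟩
        · exact ⟨!c, by simp [hneg]⟩
      obtain ⟨v', hv⟩ := SyllableMove.exists_of_count_pos h2.pos d
      have hn' := hv.count_none
      refine .inr ⟨d, v', hv, .inr ⟨by simp [h0], ?_, crossingSign c, ?_, ?_, ?_⟩⟩
      · rw [hn', Nat.odd_add_one, Nat.not_odd_iff_even] at h2
        exact h2
      · cases c <;> simp [crossingSign]
      · rw [hs, h3, zero_add]
      · rw [hv.resolvedSum_eq, h4, hd, zero_add]
    · rw [hn, h0] at h1
      exact absurd h1 (by decide)
  -- The opposite sign in the same syllable restores its sum and removes two crossings in total, so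
  -- the same alternative of `Balanced` persists.
  · obtain ⟨u'', hu'⟩ := SyllableMove.exists_of_count_pos h0 (!c)
    have hn' := hu'.count_none
    have hs' : resolvedSum u'' = resolvedSum u := by rw [hu'.resolvedSum_eq, hs, hneg]; ring
    have hp : u.count none = u''.count none + 2 := by omega
    refine .inl ⟨_, u'', hu', ?_⟩
    simp only [Balanced, hs', hp] at h ⊢
    simpa [Nat.odd_add, Nat.even_add] using h

/-- The diagrams that the second player leaves to the first, with `m` and `n` crossings in the two
syllables. -/
def BalancedPosition (δ : ℤ) (m n : ℕ) (P : PseudoDiagram) : Prop :=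
  ∃ u v : List (Option Bool), u.length = m ∧ v.length = n ∧ P = numeratorClosure u v ∧
    Balanced δ u v

theorem BalancedPosition.exists_response {δ : ℤ} (hδ : δ = 1 ∨ δ = -1) {m n : ℕ}
    {P Q : PseudoDiagram} (h : BalancedPosition δ m n P) (hPQ : GameMove P Q) :
    ∃ R, GameMove Q R ∧ BalancedPosition δ m n R := by
  obtain ⟨u, v, hu, hv, rfl, hb⟩ := h
  rcases hPQ.of_numeratorClosure with ⟨c, u', hm, rfl⟩ | ⟨c, v', hm, rfl⟩
  · rcases hb.exists_response hδ hm with ⟨d, u'', hm', hb'⟩ | ⟨d, v', hm', hb'⟩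
    · exact ⟨_, hm'.gameMove_left v, u'', v, by rw [hm'.length_eq, hm.length_eq, hu], hv, rfl, hb'⟩
    · exact ⟨_, hm'.gameMove_right u', u', v', by rw [hm.length_eq, hu],
        by rw [hm'.length_eq, hv], rfl, hb'⟩
  · rcases (hb.symm hδ).exists_response hδ hm with ⟨d, v'', hm', hb'⟩ | ⟨d, u', hm', hb'⟩
    · exact ⟨_, hm'.gameMove_right u, u, v'', hu, by rw [hm'.length_eq, hm.length_eq, hv], rfl,
        hb'.symm hδ⟩
    · exact ⟨_, hm'.gameMove_left v', u', v', by rw [hm'.length_eq, hu],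
        by rw [hm.length_eq, hv], rfl, hb'.symm hδ⟩

/-- At the end of the game the sums of the two syllables are `ε` and `δ * ε`. -/
theorem BalancedPosition.exists_of_toPseudo {δ : ℤ} {m n : ℕ} {D : Diagram}
    (h : BalancedPosition δ m n D.toPseudo) :
    ∃ (u v : List Bool) (ε : ℤ), u.length = m ∧ v.length = n ∧ D = numeratorClosure u v ∧
      (ε = 1 ∨ ε = -1) ∧ signedCount u = ε ∧ signedCount v = δ * ε := by
  obtain ⟨u, v, hu, hv, hD, hb⟩ := h
  have hu0 : u.count none = 0 := by
    by_contra h0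
    obtain ⟨u', h⟩ := SyllableMove.exists_of_count_pos (Nat.pos_of_ne_zero h0) true
    exact not_gameMove_toPseudo D _ (hD ▸ h.gameMove_left v)
  have hv0 : v.count none = 0 := by
    by_contra h0
    obtain ⟨v', h⟩ := SyllableMove.exists_of_count_pos (Nat.pos_of_ne_zero h0) true
    exact not_gameMove_toPseudo D _ (hD ▸ h.gameMove_right u)
  have lift : ∀ w : List (Option Bool), w.count none = 0 → ∃ w' : List Bool, w = w'.map some := by
    intro w hw
    have hw' := List.count_eq_zero.1 hw
    clear hw
    induction w with
    | nil => exact ⟨[], rfl⟩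
    | cons a w ih =>
      obtain ⟨w', rfl⟩ := ih fun h => hw' (List.mem_cons_of_mem _ h)
      cases a with
      | none => exact absurd List.mem_cons_self hw'
      | some a => exact ⟨a :: w', rfl⟩
  obtain ⟨u, rfl⟩ := lift u hu0
  obtain ⟨v, rfl⟩ := lift v hv0
  have hsum : ∀ w : List Bool, resolvedSum (w.map some) = signedCount w := by
    intro w
    simp only [resolvedSum, signedCount,
      List.count_map_of_injective w some (Option.some_injective Bool)]
  rcases hb with ⟨h1, -⟩ | ⟨-, -, ε, hε, h1, h2⟩
  -- The odd alternative is excluded once no crossing is unresolved.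
  · rw [hu0] at h1
    exact absurd h1 (by decide)
  · refine ⟨u, v, ε, by simpa using hu, by simpa using hv, toPseudo_injective ?_, hε, ?_, ?_⟩
    · rw [hD, Diagram.toPseudo, map_numeratorClosure]
    · rw [← hsum, h1]
    · rw [← hsum, h2]

/-- A set of positions to which the second player can return after every move of the first. -/
theorem exists_strategy {I : PseudoDiagram → Prop} {P₀ : PseudoDiagram} (h₀ : I P₀)
    (hI : ∀ P Q, I P → GameMove P Q → ∃ R, GameMove Q R ∧ I R) :
    ∃ σ : Strategy, σ.IsLegal P₀ ∧ ∀ D : Diagram, σ.Outcome P₀ D → I D.toPseudo := by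
  classical
  let σ : Strategy := fun Q => if h : ∃ R, GameMove Q R ∧ I R then h.choose else Q
  have hσ : ∀ P Q, I P → GameMove P Q → GameMove Q (σ Q) ∧ I (σ Q) := by
    intro P Q hP hPQ
    have h := hI P Q hP hPQ
    simp only [σ, dif_pos h]
    exact h.choose_spec
  have key : ∀ x P, σ.Reaches P₀ x P →
      (x = .first → I P) ∧ (x = .second → GameMove P (σ P) ∧ I (σ P)) := by
    intro x P h
    induction h with
    | start => exact ⟨fun _ => h₀, fun h => by cases h⟩
    | first _ hm ih => exact ⟨fun h => (by cases h), fun _ => hσ _ _ (ih.1 rfl) hm⟩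
    | second _ _ ih => exact ⟨fun _ => (ih.2 rfl).2, fun h => by cases h⟩
  refine ⟨σ, fun P hP _ => ((key _ P hP).2 rfl).1, ?_⟩
  rintro D ⟨x, hx⟩
  cases x with
  | first => exact (key _ _ hx).1 rfl
  -- Play cannot end with the second player to move, because the invariant always supplies an
  -- answer.
  | second => exact absurd ((key _ _ hx).2 rfl).1 (not_gameMove_toPseudo D _)

theorem Splittable.congr {D D' : Diagram} (h : Equivalent 0 0 D D') (hD : Splittable D') :
    Splittable D := by
  obtain ⟨E, hE, hE'⟩ := hD
  exact ⟨E, h.trans hE, hE'⟩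

/-- The closures of the tangles `(ε, δ * ε)` are won by the role that aims at them. -/
theorem Role.wins_of_equivalent (r : Role) {T : Diagram} {ε : ℤ} (hε : ε = 1 ∨ ε = -1)
    (hT : Equivalent 2 2 T (rationalTangle [ε, r.relativeSign * ε])) :
    r.Wins (Closure.numerator.close T) := by
  have h := hT.close_numerator
  cases r with
  | linker =>
    intro hs
    rcases hε with rfl | rfl
    · exact not_splittable_hopf true (hs.congr h.symm)
    · exact not_splittable_hopf false (hs.congr h.symm)
  | unlinker =>
    rcases hε with rfl | rfl
    · exact (splittable_unlink true).congr h
    · exact (splittable_unlink false).congr h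

end LinkGame

open LinkGame
theorem theorem4p2 (a₁ a₂ : ℤ) (ha₁ : Odd a₁) (ha₂ : Odd a₂) (κ : Closure)
    (hκ : numComponents (κ.close (rationalTangle [a₁, a₂])) = 2) (r : Role) :
    ∃ σ : Strategy,
      σ.IsWinning r (Diagram.shadow (κ.close (rationalTangle [a₁, a₂]))) ∧
      ∀ D : Diagram, σ.Outcome (Diagram.shadow (κ.close (rationalTangle [a₁, a₂]))) D →
        ∃ (u v : List Bool) (ε : ℤ), u.length = a₁.natAbs ∧ v.length = a₂.natAbs ∧
          D = κ.close (twistWord [u, v]) ∧ (ε = 1 ∨ ε = -1) ∧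
          signedCount u = ε ∧ signedCount v = r.relativeSign * ε ∧
          Equivalent 2 2 (twistWord [u, v]) (rationalTangle [ε, r.relativeSign * ε]) := by
  cases κ with
  | denominator =>
    refine absurd hκ (numComponents_denominator_ne_two _ _ (by simpa using ha₁.natAbs)
      (IsTangle.close_denominator ?_))
    exact isTangle_foldl (fun _ c h => isTangle_rightTwist h c) _
      (isTangle_foldl (fun _ c h => isTangle_bottomTwist h c) _ rfl)
  | numerator =>
    have hδ : r.relativeSign = 1 ∨ r.relativeSign = -1 := by
      cases r
      · exact .inl rfl
      · exact .inr rfl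
    have h₀ : BalancedPosition r.relativeSign a₁.natAbs a₂.natAbs
        (Diagram.shadow (Closure.numerator.close (rationalTangle [a₁, a₂]))) := by
      -- The shadow forgets the signs of `a₁` and `a₂`; their oddness puts the initial position in
      -- the odd alternative, with both sums zero.
      refine ⟨List.replicate a₁.natAbs none, List.replicate a₂.natAbs none, by simp, by simp, ?_,
        .inl ⟨by simpa using ha₁.natAbs, by simpa using ha₂.natAbs, ?_, ?_⟩⟩
      · have := map_numeratorClosure (fun _ => (none : Option Bool))
          (List.replicate a₁.natAbs (decide (0 < a₁))) (List.replicate a₂.natAbs (decide (0 < a₂)))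
        rw [List.map_replicate, List.map_replicate] at this
        exact this
      · simp [resolvedSum, List.count_replicate]
      · simp [resolvedSum, List.count_replicate]
    obtain ⟨σ, hσ, hI⟩ := exists_strategy h₀ fun P Q hP hPQ => hP.exists_response hδ hPQ
    have key : ∀ D : Diagram,
        σ.Outcome (Diagram.shadow (Closure.numerator.close (rationalTangle [a₁, a₂]))) D →
        ∃ (u v : List Bool) (ε : ℤ), u.length = a₁.natAbs ∧ v.length = a₂.natAbs ∧
          D = Closure.numerator.close (twistWord [u, v]) ∧ (ε = 1 ∨ ε = -1) ∧
          signedCount u = ε ∧ signedCount v = r.relativeSign * ε ∧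
          Equivalent 2 2 (twistWord [u, v]) (rationalTangle [ε, r.relativeSign * ε]) := by
      intro D hD
      obtain ⟨u, v, ε, hu, hv, hD, hε, h1, h2⟩ := (hI D hD).exists_of_toPseudo
      have hE := equivalent_rationalTangle u v
      rw [h1, h2] at hE
      exact ⟨u, v, ε, hu, hv, hD, hε, h1, h2, hE⟩
    refine ⟨σ, ⟨hσ, fun D hD => ?_⟩, key⟩
    obtain ⟨u, v, ε, -, -, rfl, hε, -, -, hE⟩ := key D hD
    exact r.wins_of_equivalent hε hE
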